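/- A group is \emph{minimax} if it has a series of finite length $1=G_0\lhd G_1\lhd\dots\lhd G_n=G$ in which each factor $G_{i+1}/G_i$ satisfies either the minimal or the maximal condition on subgroups. A solvable minimax group $G$ has a series of finite length in which each factor is cyclic or quasicyclic (that is, isomorphic to $\mathbb{Z}[1/p]/\mathbb{Z}$ for some prime $p$); the set of primes $p$ corresponding to the quasicyclic factors does not depend on the series and is called the \emph{spectrum} of $G$, denoted $\mathrm{spec}(G)$. For a set $\pi$ of primes, a \emph{$\pi$-minimax group} is a solvable minimax group $G$ with $\mathrm{spec}(G)\subseteq\pi$. Let $\mathfrak{X}_\pi$ be the class of all groups $G$ such that every $\pi$-minimax quotient of $G$ is torsion. For any group $G$, the \emph{$\mathfrak{X}_\pi$-radical} $\rho_\pi(G)$ is the join of all the normal subgroups of $G$ that belong to $\mathfrak{X}_\pi$. A group is \emph{virtually torsion-free} if it has a torsion-free subgroup of finite index. Corollary 5.15. Let $\pi$ be an arbitrary set of primes. If $G$ is a solvable minimax group, then $G/\rho_\pi(G)$ is a virtually torsion-free $\pi$-minimax group. -/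

import Mathlib

universe u

/-- A (subnormal) series of finite length `1 = H₀ ◁ H₁ ◁ ⋯ ◁ Hₙ = G` of a group `G`. -/
structure SubnormalSeries (G : Type u) [Group G] where
  /-- The number of factors. -/
  length : ℕ
  /-- The terms of the series. -/
  term : Fin (length + 1) → Subgroup G
  term_zero : term 0 = ⊥
  term_last : term (Fin.last length) = ⊤
  le_succ : ∀ i : Fin length, term i.castSucc ≤ term i.succ
  normal_succ : ∀ i : Fin length, ((term i.castSucc).subgroupOf (term i.succ)).Normal

attribute [instance] SubnormalSeries.normal_succ

/-- The `i`-th factor `Hᵢ₊₁ / Hᵢ` of a series; it is a group under the quotient structure. -/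
abbrev SubnormalSeries.Factor {G : Type u} [Group G] (S : SubnormalSeries G)
    (i : Fin S.length) : Type u :=
  S.term i.succ ⧸ (S.term i.castSucc).subgroupOf (S.term i.succ)

/-- A group is minimax if it has a series of finite length in which each factor satisfies
the minimal condition or the maximal condition on subgroups. -/
def IsMinimaxGroup (G : Type u) [Group G] : Prop :=
  ∃ S : SubnormalSeries G, ∀ i : Fin S.length,
    WellFoundedLT (Subgroup (S.Factor i)) ∨ WellFoundedGT (Subgroup (S.Factor i))

/-- For a prime `p`, the group `Q` is quasicyclic of type `p^∞`: it is generated by elements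
`1 = x₀, x₁, x₂, …` with `x₁ ≠ 1` and `xₙ₊₁ ^ p = xₙ`. Then `xₙ` has order `p ^ n`, and `Q` is
the union of the ascending chain of its cyclic subgroups `⟨xₙ⟩` of order `p ^ n`. -/
def IsQuasicyclic (p : Nat.Primes) (Q : Type u) [Group Q] : Prop :=
  ∃ x : ℕ → Q, x 0 = 1 ∧ x 1 ≠ 1 ∧ (∀ n, x (n + 1) ^ (p : ℕ) = x n) ∧
    Subgroup.closure (Set.range x) = ⊤

/-- Each factor of the series is cyclic or quasicyclic. -/
def SubnormalSeries.IsCyclicQuasicyclic {G : Type u} [Group G] (S : SubnormalSeries G) : Prop :=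
  ∀ i : Fin S.length, IsCyclic (S.Factor i) ∨ ∃ p : Nat.Primes, IsQuasicyclic p (S.Factor i)

/-- The spectrum of a group: the primes that correspond to the quasicyclic factors of a series
of finite length in which each factor is cyclic or quasicyclic. It is used only for solvable
minimax groups, which have such a series, and where all such series give the same primes. -/
def groupSpectrum (G : Type u) [Group G] : Set Nat.Primes :=
  {p | ∃ S : SubnormalSeries G, S.IsCyclicQuasicyclic ∧
    ∃ i : Fin S.length, IsQuasicyclic p (S.Factor i)}

/-- A `π`-minimax group is a solvable minimax group whose spectrum is contained in `π`. -/
def IsPiMinimax (π : Set Nat.Primes) (G : Type u) [Group G] : Prop :=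
  Group.IsSolvable G ∧ IsMinimaxGroup G ∧ groupSpectrum G ⊆ π

/-- The class `𝔛_π` of all groups all of whose `π`-minimax quotients are torsion. -/
def IsXGroup (π : Set Nat.Primes) (G : Type u) [Group G] : Prop :=
  ∀ (N : Subgroup G) [N.Normal], IsPiMinimax π (G ⧸ N) → IsMulTorsion (G ⧸ N)

/-- The `𝔛_π`-radical of `G`: the join of all the normal subgroups of `G` that belong
to `𝔛_π`. -/
def xRadical (π : Set Nat.Primes) (G : Type u) [Group G] : Subgroup G :=
  sSup {N : Subgroup G | N.Normal ∧ IsXGroup π N}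

instance xRadical_normal (π : Set Nat.Primes) (G : Type u) [Group G] :
    (xRadical π G).Normal := by
  rw [xRadical, sSup_eq_iSup']
  exact @Subgroup.iSup_normal G _ _ _ (fun N => N.2.1)

/-- `G` is torsion-free: no element other than `1` has finite order. (For nonabelian groups this
is weaker than injectivity of the power maps.) -/
def IsTorsionFreeGroup (G : Type u) [Group G] : Prop :=
  ∀ g : G, IsOfFinOrder g → g = 1

/-- `G` is virtually torsion-free: it has a torsion-free subgroup of finite index. -/
def IsVirtuallyTorsionFree (G : Type u) [Group G] : Prop :=
  ∃ H : Subgroup G, H.FiniteIndex ∧ IsTorsionFreeGroup H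

/-! A solvable minimax group is obtained by finitely many extensions from cyclic and quasicyclic
groups, and it is `π`-minimax exactly when the quasicyclic pieces can be taken with primes in `π`
(`isPiMinimax_iff`). The invariant behind this is a sequence of successive `p`-th roots: it has
bounded exponent when `p ∉ π`, but not in a group of type `p^∞`.

Call a normal subgroup `L` an isolated kernel if `G ⧸ L` is such a group over `π` without nontrivial
normal torsion subgroups. Isolated kernels are closed under intersection, and a rank function yields
a least one (`IsIsolatedKernel.exists_least`). It is the radical. A normal `𝔛_π`-subgroup has
torsion `π`-minimax image in `G ⧸ L`, hence lies in `L`. Conversely, the least isolated kernel of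
`L` is invariant under automorphisms, so it is normal in `G` and is an isolated kernel there; by
minimality it is `L` itself, so every `π`-minimax quotient of `L` is torsion.

It remains to see that a solvable minimax group without nontrivial normal torsion subgroups is
virtually torsion-free. Induct on the derived length, with `A` the last term of the derived series,
which is torsion-free, and `T ⧸ A` the torsion radical of `G ⧸ A`. For two primes outside the
finitely many that occur, `A` modulo `p`-th powers is finite, so a subgroup of finite index acts
trivially on both quotients. An element of finite order there that lies in `T` acts on `A` with
finite order, hence trivially. So it lies in `T ⊓ centralizer A`, which is torsion modulo its
center; by Schur's theorem its elements of finite order form a normal torsion subgroup, which is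
trivial. -/

/-! ### Classes of groups built by finitely many extensions. -/

theorem exists_injective_quotient {G H : Type*} [Group G] [Group H] {N : Subgroup G} [N.Normal]
    {M : Subgroup H} [M.Normal] (f : G →* H) (h : ∀ x, f x ∈ M ↔ x ∈ N) :
    ∃ g : G ⧸ N →* H ⧸ M, Function.Injective g := by
  refine ⟨QuotientGroup.map N M f fun x hx => (h x).2 hx, ?_⟩
  rw [injective_iff_map_eq_one]
  intro a
  induction a using QuotientGroup.induction_on with
  | H a =>
    intro ha
    have ha' : (f a : H ⧸ M) = 1 := ha
    exact (QuotientGroup.eq_one_iff _).2 ((h a).1 ((QuotientGroup.eq_one_iff _).1 ha'))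

theorem exists_surjective_quotient {G H : Type*} [Group G] [Group H] {N : Subgroup G} [N.Normal]
    {M : Subgroup H} [M.Normal] (f : G →* H) (hf : Function.Surjective f)
    (h : ∀ x ∈ N, f x ∈ M) : ∃ g : G ⧸ N →* H ⧸ M, Function.Surjective g := by
  refine ⟨QuotientGroup.map N M f h, ?_⟩
  intro y
  induction y using QuotientGroup.induction_on with
  | H y =>
    obtain ⟨x, rfl⟩ := hf y
    exact ⟨(x : _ ⧸ N), rfl⟩

/-- `PolyClass C G`: the group `G` is built from the trivial group by finitely many extensions with
quotients in the class `C`. -/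
inductive PolyClass (C : ∀ (Q : Type u) [Group Q], Prop) : ∀ (G : Type u) [Group G], Prop
  | triv (G : Type u) [Group G] [Subsingleton G] : PolyClass C G
  | step (G : Type u) [Group G] (N : Subgroup G) [N.Normal] : PolyClass C N → C (G ⧸ N) → PolyClass C G

/-- The class `C` is closed under subgroups and isomorphic copies. -/
def SubClosed (C : ∀ (Q : Type u) [Group Q], Prop) : Prop :=
  ∀ {H G : Type u} [Group H] [Group G] (f : H →* G), Function.Injective f → C G → C H

/-- The class `C` is closed under homomorphic images. -/
def QuotClosed (C : ∀ (Q : Type u) [Group Q], Prop) : Prop :=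
  ∀ {G H : Type u} [Group G] [Group H] (f : G →* H), Function.Surjective f → C G → C H

namespace PolyClass

variable {C : ∀ (Q : Type u) [Group Q], Prop}

theorem mono {D : ∀ (Q : Type u) [Group Q], Prop} (h : ∀ (Q : Type u) [Group Q], C Q → D Q)
    {G : Type u} [Group G] (hG : PolyClass C G) : PolyClass D G := by
  induction hG with
  | triv G => exact .triv G
  | step G N _ hq ih => exact .step G N ih (h _ hq)

theorem of_injective (hC : SubClosed C) {G : Type u} [Group G] (hG : PolyClass C G) :
    ∀ {H : Type u} [Group H] (f : H →* G), Function.Injective f → PolyClass C H := by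
  induction hG with
  | triv G =>
    intro H _ f hf
    have := hf.subsingleton
    exact .triv H
  | step G N _ hq ih =>
    intro H _ f hf
    obtain ⟨g, hg⟩ := exists_injective_quotient (N := N.comap f) (M := N) f fun _ => Iff.rfl
    refine .step H (N.comap f) (ih ((f.comp (N.comap f).subtype).codRestrict N fun x => x.2) ?_)
      (hC g hg hq)
    intro x y hxy
    exact Subtype.ext (hf (congrArg Subtype.val hxy))

theorem of_surjective (hC : QuotClosed C) {G : Type u} [Group G] (hG : PolyClass C G) :
    ∀ {H : Type u} [Group H] (f : G →* H), Function.Surjective f → PolyClass C H := by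
  induction hG with
  | triv G =>
    intro H _ f hf
    have := hf.subsingleton
    exact .triv H
  | step G N _ hq ih =>
    intro H _ f hf
    have : (N.map f).Normal := Subgroup.Normal.map inferInstance f hf
    obtain ⟨g, hg⟩ := exists_surjective_quotient (N := N) (M := N.map f) f hf
      fun x hx => Subgroup.mem_map_of_mem f hx
    exact .step H (N.map f) (ih (f.subgroupMap N) (f.subgroupMap_surjective N)) (hC g hg hq)

/-- The induction runs over the construction of the target `K`: its chain of subgroups, pulled back
along `f`, ends at the kernel. Leaving `G` and `f` arbitrary lets the hypothesis apply to the
restriction of `f` to the preimage of `M`. -/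
theorem of_ker (hC : SubClosed C) {K : Type u} [Group K] (hK : PolyClass C K) :
    ∀ {G : Type u} [Group G] (f : G →* K), PolyClass C f.ker → PolyClass C G := by
  induction hK with
  | triv K =>
    intro G _ f hf
    exact hf.of_injective hC ((MonoidHom.id G).codRestrict f.ker fun x => Subsingleton.elim _ _)
      fun x y hxy => congrArg Subtype.val hxy
  | step K M _ hq ih =>
    intro G _ f hf
    obtain ⟨g, hg⟩ := exists_injective_quotient (N := M.comap f) (M := M) f fun _ => Iff.rfl
    refine .step G (M.comap f)
      (ih ((f.comp (M.comap f).subtype).codRestrict M fun x => x.2) ?_) (hC g hg hq)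
    refine hf.of_injective hC
      (((M.comap f).subtype.comp (Subgroup.subtype _)).codRestrict f.ker fun x => ?_) ?_
    · exact congrArg Subtype.val x.2
    · intro x y hxy
      have := congrArg (Subtype.val : f.ker → G) hxy
      exact Subtype.ext (Subtype.ext this)

theorem of_extension (hC : SubClosed C) {G : Type u} [Group G] (N : Subgroup G) [N.Normal]
    (hN : PolyClass C N) (hQ : PolyClass C (G ⧸ N)) : PolyClass C G :=
  hQ.of_ker hC (QuotientGroup.mk' N) ((QuotientGroup.ker_mk' N).symm ▸ hN)

theorem of_class (hC : SubClosed C) {G : Type u} [Group G] (hG : C G) : PolyClass C G := by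
  refine .step G ⊥ (.triv _) (hC (QuotientGroup.quotientBot (G := G)).toMonoidHom ?_ hG)
  exact (QuotientGroup.quotientBot (G := G)).injective

/-- A subdirect product of two groups in the class lies in the class. -/
theorem of_ker_inf_ker (hC : SubClosed C) {G K₁ K₂ : Type u} [Group G] [Group K₁] [Group K₂]
    (h₁ : PolyClass C K₁) (h₂ : PolyClass C K₂) (f₁ : G →* K₁) (f₂ : G →* K₂)
    (h : ∀ x, f₁ x = 1 → f₂ x = 1 → x = 1) : PolyClass C G := by
  refine h₁.of_ker hC f₁ (h₂.of_injective hC (f₂.comp f₁.ker.subtype) ?_)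
  rw [injective_iff_map_eq_one]
  intro x hx
  exact Subtype.ext (h x x.2 hx)

end PolyClass

/-! ### Iterated extensions and subnormal series. -/

/-- `G` has a subnormal series of finite length with all factors in the class `C`. -/
def HasSeries (C : ∀ (Q : Type u) [Group Q], Prop) (G : Type u) [Group G] : Prop :=
  ∃ S : SubnormalSeries G, ∀ i : Fin S.length, C (S.Factor i)

namespace SubnormalSeries

theorem poly_term {C : ∀ (Q : Type u) [Group Q], Prop} (hC : SubClosed C) {G : Type u} [Group G]
    (S : SubnormalSeries G) (hS : ∀ i : Fin S.length, C (S.Factor i)) (i : Fin (S.length + 1)) :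
    PolyClass C (S.term i) := by
  induction i using Fin.induction with
  | zero =>
    rw [S.term_zero]
    exact .triv _
  | succ i ih =>
    refine .step _ ((S.term i.castSucc).subgroupOf (S.term i.succ)) ?_ (hS i)
    exact ih.of_injective hC (Subgroup.subgroupOfEquivOfLe (S.le_succ i)).toMonoidHom
      (Subgroup.subgroupOfEquivOfLe (S.le_succ i)).injective

end SubnormalSeries

theorem HasSeries.poly {C : ∀ (Q : Type u) [Group Q], Prop} (hC : SubClosed C) {G : Type u}
    [Group G] (h : HasSeries C G) : PolyClass C G := by
  obtain ⟨S, hS⟩ := h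
  have := S.poly_term hC hS (Fin.last _)
  rw [S.term_last] at this
  exact this.of_injective hC (Subgroup.topEquiv (G := G)).symm.toMonoidHom
    (Subgroup.topEquiv (G := G)).symm.injective

theorem PolyClass.hasSeries {C : ∀ (Q : Type u) [Group Q], Prop} (hC : SubClosed C) {G : Type u}
    [Group G] (h : PolyClass C G) : HasSeries C G := by
  induction h with
  | triv G =>
    refine ⟨⟨0, fun _ => ⊥, rfl, Subsingleton.elim _ _, fun i => i.elim0, fun i => i.elim0⟩,
      fun i => i.elim0⟩
  | step G N hN hq ih =>
    obtain ⟨S, hS⟩ := ih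
    have hcast : ∀ i : Fin S.length,
        ((S.term i.castSucc).map N.subtype).subgroupOf ((S.term i.succ).map N.subtype) =
        ((S.term i.castSucc).subgroupOf (S.term i.succ)).map
          (N.subtype.subgroupMap (S.term i.succ)) := by
      intro i
      ext ⟨x, hx⟩
      simp only [Subgroup.mem_subgroupOf, Subgroup.mem_map]
      constructor
      · rintro ⟨y, hy, rfl⟩
        exact ⟨⟨y, S.le_succ i hy⟩, hy, rfl⟩
      · rintro ⟨y, hy, h⟩
        exact ⟨y, hy, congrArg Subtype.val h⟩
    have hnorm : ∀ i : Fin S.length,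
        (((S.term i.castSucc).map N.subtype).subgroupOf
          ((S.term i.succ).map N.subtype)).Normal := by
      intro i
      rw [hcast i]
      exact (S.normal_succ i).map _ (N.subtype.subgroupMap_surjective _)
    have hnormN : (N.subgroupOf ⊤).Normal := inferInstance
    -- The series of `N`, pushed into `G`, with `⊤` appended as the last term; the new top factor is
    -- `G ⧸ N`.
    let t : Fin (S.length + 1 + 1) → Subgroup G :=
      Fin.snoc (α := fun _ => Subgroup G) (fun i => (S.term i).map N.subtype) ⊤
    have tc : ∀ i : Fin (S.length + 1), t i.castSucc = (S.term i).map N.subtype := fun i =>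
      Fin.snoc_castSucc (α := fun _ => Subgroup G) _ _ i
    have tl : t (Fin.last _) = ⊤ := Fin.snoc_last (α := fun _ => Subgroup G) _ _
    have tl' : t (Fin.last S.length).succ = ⊤ := by rw [Fin.succ_last, tl]
    have tN : t (Fin.last S.length).castSucc = N := by
      rw [tc, S.term_last, ← MonoidHom.range_eq_map, Subgroup.range_subtype]
    have ts : ∀ i : Fin S.length, t i.castSucc.succ = (S.term i.succ).map N.subtype := fun i => by
      rw [Fin.succ_castSucc, tc]
    refine ⟨⟨S.length + 1, t, ?_, tl, ?_, ?_⟩, ?_⟩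
    · have : t (Fin.castSucc 0) = ⊥ := by rw [tc, S.term_zero, Subgroup.map_bot]
      exact this
    · intro i
      refine Fin.lastCases ?_ (fun i => ?_) i
      · rw [Fin.succ_last, tl]
        exact le_top
      · rw [tc, ts]
        exact Subgroup.map_mono (S.le_succ i)
    · intro i
      refine Fin.lastCases ?_ (fun i => ?_) i
      · rw [tN, Fin.succ_last, tl]
        exact hnormN
      · rw [tc, ts]
        exact hnorm i
    · have key : ∀ (A B : Subgroup G) [(A.subgroupOf B).Normal] (D E : Subgroup G)
          [(D.subgroupOf E).Normal], A = D → B = E →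
          C (B ⧸ A.subgroupOf B) → C (E ⧸ D.subgroupOf E) := by
        rintro A B _ D E _ rfl rfl h
        exact h
      intro i
      refine Fin.lastCases ?_ (fun i => ?_) i
      · have h1 : C ((⊤ : Subgroup G) ⧸ N.subgroupOf ⊤) := by
          obtain ⟨g, hg⟩ := exists_injective_quotient (N := N.subgroupOf ⊤) (M := N)
            (Subgroup.subtype ⊤) fun x => Subgroup.mem_subgroupOf.symm
          exact hC g hg hq
        have := hnormN
        exact @key N ⊤ _ _ _ (_) tN.symm tl'.symm h1
      · have := hnorm i
        refine @key _ _ this _ _ (_) (tc _).symm (ts _).symm ?_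
        let e := Subgroup.equivMapOfInjective (S.term i.succ) N.subtype N.subtype_injective
        have hval : ∀ x, ((e.symm x : N) : G) = x := fun x =>
          congrArg Subtype.val (e.apply_symm_apply x)
        have hmem : ∀ x, e.symm x ∈ (S.term i.castSucc).subgroupOf (S.term i.succ) ↔
            x ∈ ((S.term i.castSucc).map N.subtype).subgroupOf
              ((S.term i.succ).map N.subtype) := by
          intro x
          rw [Subgroup.mem_subgroupOf, Subgroup.mem_subgroupOf, ← hval x, Subgroup.mem_map]
          constructor
          · exact fun h => ⟨_, h, rfl⟩
          · rintro ⟨y, hy, h⟩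
            rwa [← Subtype.ext h]
        obtain ⟨g, hg⟩ := exists_injective_quotient e.symm.toMonoidHom hmem
        exact hC g hg (hS i)

/-! ### Root sequences, cyclic and quasicyclic groups. -/

/-- Each term of the sequence `x` is the `p`-th power of the next one. -/
def IsRootSeq {G : Type*} [Group G] (p : ℕ) (x : ℕ → G) : Prop := ∀ n, x (n + 1) ^ p = x n

namespace IsRootSeq

variable {G : Type*} [Group G] {p : ℕ} {x : ℕ → G}

theorem pow_pow (hx : IsRootSeq p x) (n k : ℕ) : x (n + k) ^ p ^ k = x n := by
  induction k with
  | zero => simp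
  | succ k ih => rw [pow_succ', pow_mul, ← add_assoc, hx, ih]

theorem pow_pow_self (hx : IsRootSeq p x) (h0 : x 0 = 1) (n : ℕ) : x n ^ p ^ n = 1 := by
  have := hx.pow_pow 0 n
  rwa [zero_add, h0] at this

theorem map {H : Type*} [Group H] (hx : IsRootSeq p x) (f : G →* H) :
    IsRootSeq p fun n => f (x n) := fun n => by rw [← map_pow, hx]

theorem pow (hx : IsRootSeq p x) (m : ℕ) : IsRootSeq p fun n => x n ^ m := fun n => by
  rw [← pow_mul, mul_comm, pow_mul, hx]

theorem zpowers_mono (hx : IsRootSeq p x) {m n : ℕ} (h : m ≤ n) :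
    Subgroup.zpowers (x m) ≤ Subgroup.zpowers (x n) := by
  obtain ⟨k, rfl⟩ := Nat.exists_eq_add_of_le h
  rw [Subgroup.zpowers_le, ← hx.pow_pow m k]
  exact Subgroup.npow_mem_zpowers _ _

theorem mem_zpowers_of_mem_closure (hx : IsRootSeq p x) {y : G}
    (hy : y ∈ Subgroup.closure (Set.range x)) : ∃ n, y ∈ Subgroup.zpowers (x n) := by
  induction hy using Subgroup.closure_induction with
  | mem y hy =>
    obtain ⟨n, rfl⟩ := hy
    exact ⟨n, Subgroup.mem_zpowers _⟩
  | one => exact ⟨0, one_mem _⟩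
  | mul a b _ _ ha hb =>
    obtain ⟨m, hm⟩ := ha
    obtain ⟨n, hn⟩ := hb
    exact ⟨max m n, mul_mem (hx.zpowers_mono (le_max_left _ _) hm)
      (hx.zpowers_mono (le_max_right _ _) hn)⟩
  | inv a _ ha =>
    obtain ⟨m, hm⟩ := ha
    exact ⟨m, inv_mem hm⟩

/-- If `h` is `x (n + 1) ^ j` with `j` prime to `p`, then `h` generates `⟨x (n + 1)⟩`, which
contains `x k` once `n ≥ k`; this is impossible. So `p ∣ j`, and `h` descends to `⟨x n⟩`. Hence
proper subgroups of a quasicyclic group are cyclic. -/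
theorem le_zpowers_of_notMem (hx : IsRootSeq p x) (hp : p.Prime) (h0 : x 0 = 1)
    {H : Subgroup G} {k : ℕ} (hk : x k ∉ H) {h : G} (hh : h ∈ H) :
    ∀ n, h ∈ Subgroup.zpowers (x n) → h ∈ Subgroup.zpowers (x k) := by
  intro n
  induction n with
  | zero => exact fun h' => hx.zpowers_mono (Nat.zero_le k) h'
  | succ n ih =>
    intro h'
    rcases Nat.lt_or_ge n k with hnk | hnk
    · exact hx.zpowers_mono hnk h'
    obtain ⟨j, rfl⟩ := Subgroup.mem_zpowers_iff.1 h'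
    by_cases hj : (p : ℤ) ∣ j
    · obtain ⟨i, rfl⟩ := hj
      refine ih ?_
      rw [zpow_mul, zpow_natCast, hx]
      exact Subgroup.zpow_mem_zpowers _ _
    · exfalso
      have hc : IsCoprime j ((p : ℤ) ^ (n + 1)) :=
        (((Nat.prime_iff_prime_int.1 hp).coprime_iff_not_dvd.2 hj).symm).pow_right
      obtain ⟨a, b, hab⟩ := hc
      have h1 : x (n + 1) ∈ H := by
        have : x (n + 1) = (x (n + 1) ^ j) ^ a := by
          have h2 : x (n + 1) ^ (b * (p : ℤ) ^ (n + 1)) = 1 := by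
            rw [mul_comm, zpow_mul]
            have := hx.pow_pow_self h0 (n + 1)
            rw [← zpow_natCast] at this
            push_cast at this
            rw [this, one_zpow]
          calc x (n + 1) = x (n + 1) ^ (a * j + b * (p : ℤ) ^ (n + 1)) := by rw [hab, zpow_one]
            _ = _ := by rw [zpow_add, h2, mul_one, mul_comm, zpow_mul]
        rw [this]
        exact zpow_mem hh a
      have h2 : x k ∈ Subgroup.zpowers (x (n + 1)) :=
        hx.zpowers_mono (hnk.trans n.le_succ) (Subgroup.mem_zpowers _)
      exact hk ((Subgroup.zpowers_le.2 h1) h2)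

end IsRootSeq

/-- The class of cyclic groups and of quasicyclic groups of type `p^∞` with `p ∈ π`. -/
def CyclicOrQuasicyclic (π : Set Nat.Primes) (Q : Type u) [Group Q] : Prop :=
  IsCyclic Q ∨ ∃ p ∈ π, IsQuasicyclic p Q

theorem CyclicOrQuasicyclic.subClosed (π : Set Nat.Primes) :
    SubClosed.{u} (CyclicOrQuasicyclic π) := by
  rintro H G _ _ f hf (h | ⟨p, hp, x, h0, h1, hx, ht⟩)
  · exact Or.inl (isCyclic_of_injective f hf)
  · have hx' : IsRootSeq (p : ℕ) x := hx
    by_cases hall : ∀ n, x n ∈ f.range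
    · choose y hy using hall
      refine Or.inr ⟨p, hp, y, hf ?_, fun h => h1 ?_, fun n => hf ?_, ?_⟩
      · rw [hy, h0, map_one]
      · rw [← hy, h, map_one]
      · rw [map_pow, hy, hy, hx]
      · refine Subgroup.map_injective hf ?_
        rw [MonoidHom.map_closure, ← Set.range_comp]
        have : (f ∘ y) = x := funext hy
        rw [this, ht, ← MonoidHom.range_eq_map, eq_comm, eq_top_iff, ← ht, Subgroup.closure_le]
        rintro _ ⟨n, rfl⟩
        exact ⟨y n, hy n⟩
    · push Not at hall
      obtain ⟨k, hk⟩ := hall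
      have hle : ∀ h, f h ∈ Subgroup.zpowers (x k) := fun h => by
        obtain ⟨n, hn⟩ := hx'.mem_zpowers_of_mem_closure (y := f h) (ht ▸ Subgroup.mem_top _)
        exact hx'.le_zpowers_of_notMem p.2 h0 hk ⟨h, rfl⟩ n hn
      exact Or.inl (isCyclic_of_injective (f.codRestrict _ hle)
        fun a b hab => hf (congrArg Subtype.val hab))

theorem CyclicOrQuasicyclic.quotClosed (π : Set Nat.Primes) :
    QuotClosed.{u} (CyclicOrQuasicyclic π) := by
  classical
  rintro G H _ _ f hf (h | ⟨p, hp, x, h0, h1, hx, ht⟩)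
  · exact Or.inl (isCyclic_of_surjective f hf)
  · have hy : IsRootSeq (p : ℕ) fun n => f (x n) := IsRootSeq.map hx f
    have htop : Subgroup.closure (Set.range fun n => f (x n)) = ⊤ := by
      have : (Set.range fun n => f (x n)) = f '' Set.range x := (Set.range_comp f x)
      rw [this, ← MonoidHom.map_closure, ht, ← MonoidHom.range_eq_map,
        MonoidHom.range_eq_top.2 hf]
    by_cases hall : ∀ n, f (x n) = 1
    · left
      have : (Subgroup.closure (Set.range fun n => f (x n))) ≤ ⊥ := by
        rw [Subgroup.closure_le]
        rintro _ ⟨n, rfl⟩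
        exact hall n
      rw [htop, top_le_iff] at this
      have : Subsingleton H := Subgroup.subsingleton_iff.1 (subsingleton_of_bot_eq_top this)
      infer_instance
    · push Not at hall
      have hk := Nat.find_spec hall
      have hpos : Nat.find hall ≠ 0 := fun h => by
        rw [h, h0, map_one] at hk
        exact hk rfl
      obtain ⟨k, hk'⟩ := Nat.exists_eq_succ_of_ne_zero hpos
      have hk1 : f (x k) = 1 := by
        by_contra h
        have := Nat.find_min' hall h
        omega
      -- `k + 1` is the first index with nontrivial image, so the shift by `k` makes term `0`
      -- trivial and term `1` nontrivial.
      refine Or.inr ⟨p, hp, fun n => f (x (k + n)), hk1, ?_, fun n => hy (k + n), ?_⟩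
      · rw [hk'] at hk
        exact hk
      · rw [eq_top_iff, ← htop, Subgroup.closure_le]
        rintro _ ⟨n, rfl⟩
        have hle : Subgroup.zpowers (f (x (k + n))) ≤
            Subgroup.closure (Set.range fun n => f (x (k + n))) :=
          Subgroup.zpowers_le.2 (Subgroup.subset_closure ⟨n, rfl⟩)
        exact hle (hy.zpowers_mono (Nat.le_add_left n k) (Subgroup.mem_zpowers _))

theorem CyclicOrQuasicyclic.mono {π π' : Set Nat.Primes} (h : π ⊆ π') {Q : Type u} [Group Q]
    (hQ : CyclicOrQuasicyclic π Q) : CyclicOrQuasicyclic π' Q :=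
  hQ.imp_right fun ⟨p, hp, hq⟩ => ⟨p, h hp, hq⟩

theorem IsQuasicyclic.pow_eq_one {p : Nat.Primes} {Q : Type u} [Group Q] (hQ : IsQuasicyclic p Q)
    (y : Q) : ∃ n, y ^ (p : ℕ) ^ n = 1 := by
  obtain ⟨x, h0, -, hx, ht⟩ := hQ
  have hx' : IsRootSeq (p : ℕ) x := hx
  obtain ⟨n, hn⟩ := hx'.mem_zpowers_of_mem_closure (y := y) (ht ▸ Subgroup.mem_top _)
  obtain ⟨j, rfl⟩ := Subgroup.mem_zpowers_iff.1 hn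
  refine ⟨n, ?_⟩
  rw [← zpow_natCast, ← zpow_mul, mul_comm, zpow_mul, zpow_natCast, hx'.pow_pow_self h0, one_zpow]

/-! ### The spectrum is determined by root sequences. -/

/-- A sequence of successive `p`-th roots in a cyclic group or a quasicyclic group for another
prime has bounded exponent. -/
theorem CyclicOrQuasicyclic.exists_pow_eq_one {π : Set Nat.Primes} {p : Nat.Primes} (hp : p ∉ π)
    {Q : Type u} [Group Q] (hQ : CyclicOrQuasicyclic π Q) {x : ℕ → Q}
    (hx : IsRootSeq (p : ℕ) x) : ∃ m, 0 < m ∧ ∀ n, x n ^ m = 1 := by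
  rcases hQ with h | ⟨q, hq, hQ⟩
  · rcases finite_or_infinite Q with hf | hf
    · exact ⟨Nat.card Q, Nat.card_pos, fun n => pow_card_eq_one'⟩
    · obtain ⟨g, hg⟩ := h.exists_generator
      have hinj : Function.Injective fun n : ℤ => g ^ n :=
        injective_zpow_iff_not_isOfFinOrder.2 (by
          rw [← orderOf_eq_zero_iff, orderOf_eq_card_of_forall_mem_zpowers hg,
            Nat.card_eq_zero_of_infinite])
      refine ⟨1, one_pos, fun n => ?_⟩
      choose j hj using fun n => Subgroup.mem_zpowers_iff.1 (hg (x n))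
      have hdvd : ∀ k, ((p : ℕ) : ℤ) ^ k ∣ j n := fun k => by
        refine ⟨j (n + k), hinj ?_⟩
        change g ^ j n = g ^ _
        rw [hj, mul_comm, zpow_mul, hj, ← hx.pow_pow n k, ← zpow_natCast]
        push_cast
        rfl
      have : j n = 0 := by
        by_contra hne
        have hfin := (Int.finiteMultiplicity_iff (a := ((p : ℕ) : ℤ)) (b := j n)).2
          ⟨by simpa using p.2.ne_one, hne⟩
        obtain ⟨k, hk⟩ := hfin
        exact hk (hdvd _)
      rw [pow_one, ← hj, this, zpow_zero]
  · obtain ⟨e, he⟩ := hQ.pow_eq_one (x 0)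
    refine ⟨(q : ℕ) ^ e, pow_pos q.2.pos _, fun n => ?_⟩
    have h1 := (hx.pow ((q : ℕ) ^ e)).pow_pow_self he n
    obtain ⟨k, hk⟩ := hQ.pow_eq_one (x n ^ (q : ℕ) ^ e)
    have hne : (p : ℕ) ≠ q := fun h => hp (by rwa [Subtype.ext h])
    have hc : Nat.Coprime ((p : ℕ) ^ n) ((q : ℕ) ^ k) :=
      Nat.Coprime.pow _ _ ((Nat.coprime_primes p.2 q.2).2 hne)
    have := pow_gcd_eq_one.2 ⟨h1, hk⟩
    rwa [hc, pow_one] at this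

theorem PolyClass.exists_pow_eq_one {π : Set Nat.Primes} {p : Nat.Primes} (hp : p ∉ π)
    {G : Type u} [Group G] (hG : PolyClass (CyclicOrQuasicyclic π) G) :
    ∀ {x : ℕ → G}, IsRootSeq (p : ℕ) x → ∃ m, 0 < m ∧ ∀ n, x n ^ m = 1 := by
  induction hG with
  | triv G => exact fun _ => ⟨1, one_pos, fun _ => Subsingleton.elim _ _⟩
  | step G N _ hq ih =>
    intro x hx
    obtain ⟨m, hm, h⟩ := hq.exists_pow_eq_one hp (hx.map (QuotientGroup.mk' N))
    have hN : ∀ n, x n ^ m ∈ N := fun n => by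
      rw [← QuotientGroup.eq_one_iff]
      exact h n
    have hy : IsRootSeq (p : ℕ) fun n => (⟨x n ^ m, hN n⟩ : N) :=
      fun n => Subtype.ext (hx.pow m n)
    obtain ⟨k, hk, h'⟩ := ih hy
    refine ⟨m * k, mul_pos hm hk, fun n => ?_⟩
    rw [pow_mul]
    exact congrArg Subtype.val (h' n)

/-- The defining root sequence has elements of order `p ^ n` for every `n`, so no common exponent
exists. -/
theorem IsQuasicyclic.mem_of_polyClass {π : Set Nat.Primes} {p : Nat.Primes} {Q : Type u}
    [Group Q] (hQ : IsQuasicyclic p Q) (h : PolyClass (CyclicOrQuasicyclic π) Q) : p ∈ π := by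
  by_contra hp
  obtain ⟨x, h0, h1, hx, -⟩ := hQ
  have hx' : IsRootSeq (p : ℕ) x := hx
  obtain ⟨m, hm, hxm⟩ := h.exists_pow_eq_one hp hx'
  have hm' : ∀ n, orderOf (x (n + 1)) = (p : ℕ) ^ (n + 1) := fun n => by
    have : Fact (p : ℕ).Prime := ⟨p.2⟩
    refine orderOf_eq_prime_pow ?_ (hx'.pow_pow_self h0 _)
    rw [add_comm n 1, hx'.pow_pow 1 n]
    exact h1
  have := orderOf_dvd_of_pow_eq_one (hxm (m + 1))
  rw [hm'] at this
  have h2 := Nat.le_of_dvd hm this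
  have h3 := Nat.lt_pow_self p.2.one_lt (n := m + 1)
  omega

/-- A factor of any series is a quotient of a subgroup of `G`, so it inherits the construction over
`π`. This gives the independence of the spectrum from the series. -/
theorem groupSpectrum_subset {π : Set Nat.Primes} {G : Type u} [Group G]
    (hG : PolyClass (CyclicOrQuasicyclic π) G) : groupSpectrum G ⊆ π := by
  rintro p ⟨S, -, i, hi⟩
  refine hi.mem_of_polyClass (PolyClass.of_surjective (CyclicOrQuasicyclic.quotClosed π) ?_
    (QuotientGroup.mk' _) (QuotientGroup.mk'_surjective _))
  exact hG.of_injective (CyclicOrQuasicyclic.subClosed π) (S.term i.succ).subtype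
    (Subgroup.subtype_injective _)

theorem polyClass_of_groupSpectrum_subset {π : Set Nat.Primes} {G : Type u} [Group G]
    (hG : PolyClass (CyclicOrQuasicyclic Set.univ) G) (h : groupSpectrum G ⊆ π) :
    PolyClass (CyclicOrQuasicyclic π) G := by
  obtain ⟨S, hS⟩ := hG.hasSeries (CyclicOrQuasicyclic.subClosed _)
  have hS' : S.IsCyclicQuasicyclic := fun i => (hS i).imp_right fun ⟨p, _, hp⟩ => ⟨p, hp⟩
  exact HasSeries.poly (CyclicOrQuasicyclic.subClosed _)
    ⟨S, fun i => (hS i).imp_right fun ⟨p, _, hp⟩ => ⟨p, h ⟨S, hS', i, hp⟩, hp⟩⟩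

/-! ### From the chain conditions to cyclic and quasicyclic factors. -/

/-- The minimal or the maximal condition on subgroups. -/
def MinOrMax (Q : Type u) [Group Q] : Prop :=
  WellFoundedLT (Subgroup Q) ∨ WellFoundedGT (Subgroup Q)

theorem Subgroup.map_strictMono_of_injective {H G : Type*} [Group H] [Group G] {f : H →* G}
    (hf : Function.Injective f) : StrictMono (Subgroup.map f) :=
  (Subgroup.gc_map_comap f).monotone_l.strictMono_of_injective (Subgroup.map_injective hf)

theorem Subgroup.comap_strictMono_of_surjective {H G : Type*} [Group H] [Group G] {f : H →* G}
    (hf : Function.Surjective f) : StrictMono (Subgroup.comap f) :=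
  (Subgroup.gc_map_comap f).monotone_u.strictMono_of_injective (Subgroup.comap_injective hf)

theorem MinOrMax.subClosed : SubClosed.{u} MinOrMax := by
  rintro H G _ _ f hf (h | h)
  · exact Or.inl (Subgroup.map_strictMono_of_injective hf).wellFoundedLT
  · exact Or.inr (Subgroup.map_strictMono_of_injective hf).wellFoundedGT

theorem MinOrMax.quotClosed : QuotClosed.{u} MinOrMax := by
  rintro H G _ _ f hf (h | h)
  · exact Or.inl (Subgroup.comap_strictMono_of_surjective hf).wellFoundedLT
  · exact Or.inr (Subgroup.comap_strictMono_of_surjective hf).wellFoundedGT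

section Cocyclic

/-- Every element outside a subgroup `B` of an abelian group survives, as an element of every
nontrivial subgroup, in some quotient by a subgroup containing `B`. -/
theorem exists_cocyclic_quotient {H : Type*} [CommGroup H] (B : Subgroup H) {y : H} (hy : y ∉ B) :
    ∃ M : Subgroup H, B ≤ M ∧ (y : H ⧸ M) ≠ 1 ∧
      ∀ K : Subgroup (H ⧸ M), K ≠ ⊥ → (y : H ⧸ M) ∈ K := by
  obtain ⟨M, hBM, hM⟩ := zorn_le_nonempty₀ {M : Subgroup H | y ∉ M} (by
    intro c hc hchain K hK
    refine ⟨sSup c, fun h => ?_, fun z hz => le_sSup hz⟩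
    obtain ⟨L, hL, hyL⟩ := (Subgroup.mem_sSup_of_directedOn ⟨K, hK⟩ hchain.directedOn).1 h
    exact hc hL hyL) B hy
  refine ⟨M, hBM, fun h => hM.1 ((QuotientGroup.eq_one_iff _).1 h), fun K hK => ?_⟩
  by_contra hyK
  have hle : M ≤ K.comap (QuotientGroup.mk' M) := fun m hm => by
    rw [Subgroup.mem_comap, QuotientGroup.mk'_apply, (QuotientGroup.eq_one_iff m).2 hm]
    exact one_mem K
  have hge := hM.2 (y := K.comap (QuotientGroup.mk' M)) hyK hle
  refine hK ((Subgroup.eq_bot_iff_forall _).2 fun k hk => ?_)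
  obtain ⟨x, rfl⟩ := QuotientGroup.mk'_surjective M k
  exact (QuotientGroup.eq_one_iff x).2 (hge hk)

variable {Q : Type*} [CommGroup Q] {p : ℕ} {y : Q}

theorem isCyclic_of_cocyclic (hp : p.Prime) (hpow : ∀ z : Q, z ^ p = 1)
    (hy : ∀ K : Subgroup Q, K ≠ ⊥ → y ∈ K) (hy1 : y ≠ 1) : IsCyclic Q := by
  refine ⟨y, fun z => ?_⟩
  by_cases hz : z = 1
  · rw [hz]
    exact one_mem (Subgroup.zpowers y)
  obtain ⟨j, rfl⟩ := Subgroup.mem_zpowers_iff.1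
    (hy (Subgroup.zpowers z) (by rwa [Ne, Subgroup.zpowers_eq_bot]))
  have hj : ¬ (p : ℤ) ∣ j := by
    rintro ⟨i, rfl⟩
    rw [zpow_mul, zpow_natCast, hpow, one_zpow] at hy1
    exact hy1 rfl
  obtain ⟨a, b, hab⟩ := ((Nat.prime_iff_prime_int.1 hp).coprime_iff_not_dvd.2 hj)
  refine Subgroup.mem_zpowers_iff.2 ⟨b, ?_⟩
  calc (z ^ j) ^ b = z ^ (a * p + b * j) := by
        rw [zpow_add, mul_comm a, zpow_mul z p, zpow_natCast, hpow, one_zpow, one_mul, mul_comm b,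
          zpow_mul]
    _ = z := by rw [hab, zpow_one]

/-- Since `y` is a power of `z`, the order of `z` is finite, say `p ^ e * m` with `p ∤ m`. If `z ^ p
^ e` were nontrivial, `y` would be a power of it, so `y ^ m = 1` and `y ^ p = 1` would force `y =
1`. -/
theorem exists_pow_prime_pow_eq_one_of_cocyclic (hp : p.Prime) (hyp : y ^ p = 1)
    (hy : ∀ K : Subgroup Q, K ≠ ⊥ → y ∈ K) (hy1 : y ≠ 1) (z : Q) : ∃ n, z ^ p ^ n = 1 := by
  have hzy : ∀ z : Q, z ≠ 1 → y ∈ Subgroup.zpowers z := fun z hz =>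
    hy _ (by rwa [Ne, Subgroup.zpowers_eq_bot])
  by_cases hz : z = 1
  · exact ⟨0, by rw [hz, one_pow]⟩
  have hfin : IsOfFinOrder z := by
    obtain ⟨j, hj⟩ := Subgroup.mem_zpowers_iff.1 (hzy z hz)
    rw [isOfFinOrder_iff_zpow_eq_one]
    refine ⟨j * p, mul_ne_zero ?_ (by exact_mod_cast hp.ne_zero), ?_⟩
    · rintro rfl
      rw [zpow_zero] at hj
      exact hy1 hj.symm
    · rw [zpow_mul, hj, zpow_natCast, hyp]
  obtain ⟨e, m, hm, hem⟩ :=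
    Nat.exists_eq_pow_mul_and_not_dvd hfin.orderOf_pos.ne' p hp.ne_one
  refine ⟨e, ?_⟩
  by_contra hne
  obtain ⟨j, hj⟩ := Subgroup.mem_zpowers_iff.1 (hzy _ hne)
  have h1 : y ^ m = 1 := by
    rw [← hj, ← zpow_natCast, ← zpow_mul, mul_comm, zpow_mul, zpow_natCast, ← pow_mul, ← hem,
      pow_orderOf_eq_one, one_zpow]
  have hc : Nat.gcd p m = 1 := (hp.coprime_iff_not_dvd).2 hm
  have := pow_gcd_eq_one.2 ⟨hyp, h1⟩
  rw [hc, pow_one] at this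
  exact hy1 this

end Cocyclic

/-- Iterated roots of `y` generate a `p`-divisible subgroup containing all elements of order `p`.
Dividing `z` by a root of `z ^ p` inside it leaves an element killed by `p`, so induction on the
exponent shows that it is everything. -/
theorem isQuasicyclic_of_cocyclic {Q : Type u} [CommGroup Q] (p : Nat.Primes) {y : Q}
    (hyp : y ^ (p : ℕ) = 1) (hdiv : ∀ z : Q, ∃ w, w ^ (p : ℕ) = z)
    (hy : ∀ K : Subgroup Q, K ≠ ⊥ → y ∈ K) (hy1 : y ≠ 1) : IsQuasicyclic p Q := by
  choose r hr using hdiv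
  let x : ℕ → Q := fun n => Nat.casesOn n 1 fun n => r^[n] y
  have hx : IsRootSeq (p : ℕ) x := by
    rintro (_ | n)
    · exact hyp
    · change (r^[n + 1] y) ^ (p : ℕ) = r^[n] y
      rw [Function.iterate_succ_apply', hr]
  refine ⟨x, rfl, hy1, hx, eq_top_iff.2 fun z _ => ?_⟩
  have hroot : ∀ k ∈ Subgroup.closure (Set.range x),
      ∃ w ∈ Subgroup.closure (Set.range x), w ^ (p : ℕ) = k := fun k hk => by
    obtain ⟨n, hn⟩ := hx.mem_zpowers_of_mem_closure hk
    obtain ⟨j, rfl⟩ := Subgroup.mem_zpowers_iff.1 hn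
    have hmem : x (n + 1) ∈ Subgroup.closure (Set.range x) :=
      Subgroup.subset_closure (Set.mem_range_self (n + 1))
    refine ⟨x (n + 1) ^ j, zpow_mem hmem j, ?_⟩
    rw [← zpow_natCast, ← zpow_mul, mul_comm, zpow_mul, zpow_natCast, hx]
  have hsoc : ∀ w : Q, w ^ (p : ℕ) = 1 → w ∈ Subgroup.zpowers y := fun w hw => by
    by_cases hw1 : w = 1
    · rw [hw1]
      exact one_mem _
    obtain ⟨j, hj⟩ := Subgroup.mem_zpowers_iff.1
      (hy (Subgroup.zpowers w) (by rwa [Ne, Subgroup.zpowers_eq_bot]))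
    have hpj : ¬ ((p : ℕ) : ℤ) ∣ j := by
      rintro ⟨i, rfl⟩
      rw [zpow_mul, zpow_natCast, hw, one_zpow] at hj
      exact hy1 hj.symm
    obtain ⟨a, b, hab⟩ := ((Nat.prime_iff_prime_int.1 p.2).coprime_iff_not_dvd.2 hpj)
    refine Subgroup.mem_zpowers_iff.2 ⟨b, ?_⟩
    calc y ^ b = w ^ (a * (p : ℕ) + b * j) := by
          rw [zpow_add, mul_comm a, zpow_mul w (p : ℕ), zpow_natCast, hw, one_zpow, one_mul,
            mul_comm b, zpow_mul, hj]
      _ = w := by rw [hab, zpow_one]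
  obtain ⟨n, hn⟩ := exists_pow_prime_pow_eq_one_of_cocyclic p.2 hyp hy hy1 z
  induction n generalizing z with
  | zero =>
    rw [pow_zero, pow_one] at hn
    rw [hn]
    exact one_mem _
  | succ n ih =>
    have h1 := ih (z ^ (p : ℕ)) trivial (by rw [← pow_mul, ← pow_succ', hn])
    obtain ⟨w, hw, hwz⟩ := hroot _ h1
    have h2 : z * w⁻¹ ∈ Subgroup.closure (Set.range x) :=
      (Subgroup.zpowers_le.2 (Subgroup.subset_closure (Set.mem_range_self 1) :
        x 1 ∈ Subgroup.closure (Set.range x))) (hsoc (z * w⁻¹) (by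
        rw [mul_pow, inv_pow, hwz, mul_inv_cancel]))
    have := mul_mem h2 hw
    rwa [inv_mul_cancel_right] at this

theorem exists_orderOf_prime_of_wellFoundedLT {H : Type*} [Group H] [Nontrivial H]
    [WellFoundedLT (Subgroup H)] : ∃ (p : ℕ) (y : H), p.Prime ∧ orderOf y = p := by
  obtain ⟨K, hK, hmin⟩ := (wellFounded_lt (α := Subgroup H)).has_min {K | K ≠ ⊥}
    ⟨⊤, top_ne_bot⟩
  obtain ⟨⟨z, hzK⟩, hz'⟩ := Subgroup.ne_bot_iff_exists_ne_one.1 hK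
  have hz : z ≠ 1 := fun h => hz' (Subtype.ext h)
  have hfin : IsOfFinOrder z := by
    by_cases h2 : z ^ 2 = 1
    · exact isOfFinOrder_iff_pow_eq_one.2 ⟨2, two_pos, h2⟩
    -- By minimality `⟨z ^ 2⟩` is all of `K`, so `z` is a power of `z ^ 2` and satisfies a relation
    -- with odd, hence nonzero, exponent.
    · have hle : Subgroup.zpowers (z ^ 2) ≤ K :=
        Subgroup.zpowers_le.2 (pow_mem hzK 2)
      have heq : Subgroup.zpowers (z ^ 2) = K := by
        by_contra hne
        exact hmin _ (by rwa [Set.mem_ofPred_eq, Ne, Subgroup.zpowers_eq_bot])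
          (lt_of_le_of_ne hle hne)
      have hz' : z ∈ Subgroup.zpowers (z ^ 2) := heq ▸ hzK
      obtain ⟨j, hj⟩ := Subgroup.mem_zpowers_iff.1 hz'
      rw [isOfFinOrder_iff_zpow_eq_one]
      refine ⟨2 * j - 1, by omega, ?_⟩
      rw [zpow_sub_one, zpow_mul]
      exact_mod_cast mul_inv_eq_one.2 hj
  have hne : orderOf z ≠ 1 := by rwa [Ne, orderOf_eq_one_iff]
  exact ⟨_, _, Nat.minFac_prime hne,
    orderOf_pow_orderOf_div hfin.orderOf_pos.ne' (Nat.minFac_dvd _)⟩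

/-- If `H` is divisible, a cocyclic quotient in which an element of prime order survives is
quasicyclic. Otherwise some `y` is not a `p`-th power, and a cocyclic quotient of `H` modulo `p`-th
powers in which `y` survives is cyclic. -/
theorem exists_cyclicOrQuasicyclic_quotient (H : Type u) [CommGroup H] [Nontrivial H]
    [WellFoundedLT (Subgroup H)] :
    ∃ M : Subgroup H, M ≠ ⊤ ∧ CyclicOrQuasicyclic Set.univ (H ⧸ M) := by
  have hproper : ∀ (M : Subgroup H) (y : H), (y : H ⧸ M) ≠ 1 → M ≠ ⊤ := by
    rintro M y hy rfl
    exact hy ((QuotientGroup.eq_one_iff y).2 trivial)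
  by_cases hdiv : ∀ (p : ℕ), p.Prime → ∀ z : H, ∃ w, w ^ p = z
  · obtain ⟨p, y, hp, hy⟩ := exists_orderOf_prime_of_wellFoundedLT (H := H)
    have hy1 : y ∉ (⊥ : Subgroup H) := fun h => by
      rw [Subgroup.mem_bot] at h
      rw [h, orderOf_one] at hy
      exact hp.ne_one hy.symm
    obtain ⟨M, -, h1, h2⟩ := exists_cocyclic_quotient ⊥ hy1
    refine ⟨M, hproper M y h1, Or.inr ⟨⟨p, hp⟩, trivial,
      isQuasicyclic_of_cocyclic ⟨p, hp⟩ ?_ ?_ h2 h1⟩⟩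
    · rw [← QuotientGroup.mk_pow]
      change ((y ^ p : H) : H ⧸ M) = 1
      rw [← hy, pow_orderOf_eq_one]
      rfl
    · intro z
      obtain ⟨x, rfl⟩ := QuotientGroup.mk'_surjective M z
      obtain ⟨w, rfl⟩ := hdiv p hp x
      exact ⟨(w : H ⧸ M), rfl⟩
  · push Not at hdiv
    obtain ⟨p, hp, y, hy⟩ := hdiv
    obtain ⟨M, hM, h1, h2⟩ := exists_cocyclic_quotient (powMonoidHom p : H →* H).range (y := y)
      (by rintro ⟨w, hw⟩; exact hy w hw)
    refine ⟨M, hproper M y h1, Or.inl (isCyclic_of_cocyclic hp ?_ h2 h1)⟩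
    intro z
    obtain ⟨x, rfl⟩ := QuotientGroup.mk'_surjective M z
    exact (QuotientGroup.eq_one_iff (x ^ p)).2 (hM ⟨x, rfl⟩)

theorem polyClass_of_comm_of_wellFoundedLT (A : Type u) [CommGroup A]
    [h : WellFoundedLT (Subgroup A)] : PolyClass (CyclicOrQuasicyclic Set.univ) A := by
  have key : ∀ K : Subgroup A, PolyClass (CyclicOrQuasicyclic Set.univ) K := by
    intro K
    induction K using WellFoundedLT.induction with
    | ind K ih =>
      rcases subsingleton_or_nontrivial K with hs | hn
      · exact .triv _
      · have : WellFoundedLT (Subgroup K) :=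
          (Subgroup.map_strictMono_of_injective K.subtype_injective).wellFoundedLT
        obtain ⟨M, hM, hq⟩ := exists_cyclicOrQuasicyclic_quotient K
        refine .step K M ?_ hq
        have hlt : M.map K.subtype < K := by
          have h1 := Subgroup.map_strictMono_of_injective K.subtype_injective
            (lt_top_iff_ne_top.2 hM)
          rwa [← MonoidHom.range_eq_map, Subgroup.range_subtype] at h1
        exact (ih _ hlt).of_injective (CyclicOrQuasicyclic.subClosed _)
          (M.equivMapOfInjective K.subtype K.subtype_injective).toMonoidHom
          (M.equivMapOfInjective K.subtype K.subtype_injective).injective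
  exact (key ⊤).of_injective (CyclicOrQuasicyclic.subClosed _)
    (Subgroup.topEquiv (G := A)).symm.toMonoidHom (Subgroup.topEquiv (G := A)).symm.injective

/-- Induction from the top down over quotients `A ⧸ K`: adjoining one element `x` to `K` changes the
quotient by a cyclic kernel. -/
theorem polyClass_of_comm_of_wellFoundedGT (A : Type u) [CommGroup A]
    [h : WellFoundedGT (Subgroup A)] : PolyClass (CyclicOrQuasicyclic Set.univ) A := by
  have key : ∀ K : Subgroup A, PolyClass (CyclicOrQuasicyclic Set.univ) (A ⧸ K) := by
    intro K
    induction K using WellFoundedGT.induction with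
    | ind K ih =>
      by_cases htop : K = ⊤
      · subst htop
        have : Subsingleton (A ⧸ (⊤ : Subgroup A)) := QuotientGroup.subsingleton_quotient_top
        exact .triv _
      obtain ⟨x, hx⟩ : ∃ x, x ∉ K := by
        by_contra! hcon
        exact htop (eq_top_iff.2 fun x _ => hcon x)
      have hle : K ≤ K ⊔ Subgroup.zpowers x := le_sup_left
      have hxm : x ∈ K ⊔ Subgroup.zpowers x :=
        (le_sup_right : Subgroup.zpowers x ≤ _) (Subgroup.mem_zpowers x)
      have hlt : K < K ⊔ Subgroup.zpowers x := lt_of_le_of_ne hle fun h => hx (h ▸ hxm)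
      refine (ih _ hlt).of_ker (CyclicOrQuasicyclic.subClosed _)
        (QuotientGroup.map K _ (MonoidHom.id A) hle) ?_
      refine PolyClass.of_class (CyclicOrQuasicyclic.subClosed _) (Or.inl ?_)
      refine isCyclic_of_injective (G' := Subgroup.zpowers (x : A ⧸ K))
        (MonoidHom.codRestrict (Subgroup.subtype _) (Subgroup.zpowers (x : A ⧸ K)) ?_)
        fun a b hab => Subtype.ext
          (congrArg (Subtype.val : Subgroup.zpowers (x : A ⧸ K) → A ⧸ K) hab)
      rintro ⟨a, ha⟩
      obtain ⟨a, rfl⟩ := QuotientGroup.mk'_surjective K a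
      have ha' : a ∈ K ⊔ Subgroup.zpowers x := (QuotientGroup.eq_one_iff a).1 ha
      obtain ⟨k, hk, z, hz, rfl⟩ := Subgroup.mem_sup.1 ha'
      obtain ⟨j, rfl⟩ := Subgroup.mem_zpowers_iff.1 hz
      refine Subgroup.mem_zpowers_iff.2 ⟨j, ?_⟩
      change _ = QuotientGroup.mk' K (k * x ^ j)
      rw [map_mul, (QuotientGroup.eq_one_iff k).2 hk |> fun h => (h : QuotientGroup.mk' K k = 1),
        one_mul, map_zpow]
      rfl
  exact (key ⊥).of_injective (CyclicOrQuasicyclic.subClosed _)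
    (QuotientGroup.quotientBot (G := A)).symm.toMonoidHom
    (QuotientGroup.quotientBot (G := A)).symm.injective

theorem commute_of_derivedSeries_succ_eq_bot {G : Type*} [Group G] {n : ℕ}
    (h : derivedSeries G (n + 1) = ⊥) {a b : G} (ha : a ∈ derivedSeries G n)
    (hb : b ∈ derivedSeries G n) : a * b = b * a := by
  rw [derivedSeries_succ, Subgroup.commutator_eq_bot_iff_le_centralizer] at h
  exact ((Subgroup.mem_centralizer_iff.1 (h ha)) b hb).symm

theorem derivedSeries_eq_bot_of_surjective {G H : Type*} [Group G] [Group H] {f : G →* H}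
    (hf : Function.Surjective f) {n : ℕ} (h : derivedSeries G n ≤ f.ker) :
    derivedSeries H n = ⊥ := by
  rw [← map_derivedSeries_eq hf, eq_bot_iff, Subgroup.map_le_iff_le_comap]
  exact h

theorem polyClass_of_minOrMax {n : ℕ} : ∀ {G : Type u} [Group G], derivedSeries G n = ⊥ →
    MinOrMax G → PolyClass (CyclicOrQuasicyclic Set.univ) G := by
  induction n with
  | zero =>
    intro G _ h _
    rw [derivedSeries_zero] at h
    have : Subsingleton G := Subgroup.subsingleton_iff.1 (subsingleton_of_bot_eq_top h.symm)
    exact .triv G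
  | succ n ih =>
    intro G _ h hG
    refine PolyClass.of_extension (CyclicOrQuasicyclic.subClosed _) (derivedSeries G n) ?_
      (ih (derivedSeries_eq_bot_of_surjective (QuotientGroup.mk'_surjective _)
        (QuotientGroup.ker_mk' _).ge) (hG.quotClosed (QuotientGroup.mk' _)
          (QuotientGroup.mk'_surjective _)))
    let _ : CommGroup (derivedSeries G n) :=
      { (inferInstance : Group (derivedSeries G n)) with
        mul_comm := fun a b => Subtype.ext (commute_of_derivedSeries_succ_eq_bot h a.2 b.2) }
    rcases MinOrMax.subClosed (derivedSeries G n).subtype (Subgroup.subtype_injective _) hG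
      with h | h
    · exact polyClass_of_comm_of_wellFoundedLT _
    · exact polyClass_of_comm_of_wellFoundedGT _

theorem polyClass_of_isSolvable_of_isMinimaxGroup {G : Type u} [Group G]
    (hs : Group.IsSolvable G) (hm : IsMinimaxGroup G) :
    PolyClass (CyclicOrQuasicyclic Set.univ) G := by
  have hG : PolyClass MinOrMax G := HasSeries.poly MinOrMax.subClosed hm
  clear hm
  induction hG with
  | triv G => exact .triv G
  | step G N _ hq ih =>
    obtain ⟨n, hn⟩ := (Group.isSolvable_def (G ⧸ N)).1 inferInstance
    exact PolyClass.of_extension (CyclicOrQuasicyclic.subClosed _) N (ih inferInstance)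
      (polyClass_of_minOrMax hn hq)

theorem IsMinimaxGroup.of_injective {G H : Type u} [Group G] [Group H] (hG : IsMinimaxGroup G)
    (f : H →* G) (hf : Function.Injective f) : IsMinimaxGroup H :=
  ((HasSeries.poly MinOrMax.subClosed hG).of_injective MinOrMax.subClosed f hf).hasSeries
    MinOrMax.subClosed

theorem IsMinimaxGroup.of_surjective {G H : Type u} [Group G] [Group H] (hG : IsMinimaxGroup G)
    (f : G →* H) (hf : Function.Surjective f) : IsMinimaxGroup H :=
  ((HasSeries.poly MinOrMax.subClosed hG).of_surjective MinOrMax.quotClosed f hf).hasSeries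
    MinOrMax.subClosed

theorem isPiMinimax_iff {π : Set Nat.Primes} {G : Type u} [Group G] (hs : Group.IsSolvable G)
    (hm : IsMinimaxGroup G) :
    IsPiMinimax π G ↔ PolyClass (CyclicOrQuasicyclic π) G :=
  ⟨fun h => polyClass_of_groupSpectrum_subset
    (polyClass_of_isSolvable_of_isMinimaxGroup hs hm) h.2.2,
    fun h => ⟨hs, hm, groupSpectrum_subset h⟩⟩

/-- This leaves primes outside `π`, at which torsion-free abelian subgroups have no nontrivial
elements of infinite height. -/
theorem PolyClass.exists_finite_primes {G : Type u} [Group G]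
    (hG : PolyClass (CyclicOrQuasicyclic Set.univ) G) :
    ∃ π : Set Nat.Primes, π.Finite ∧ PolyClass (CyclicOrQuasicyclic π) G := by
  induction hG with
  | triv G => exact ⟨∅, Set.finite_empty, .triv G⟩
  | step G N _ hq ih =>
    obtain ⟨π, hπ, hN⟩ := ih
    rcases hq with hq | ⟨p, -, hq⟩
    · exact ⟨π, hπ, .step G N hN (Or.inl hq)⟩
    · exact ⟨insert p π, hπ.insert p,
        .step G N (hN.mono fun _ _ h => h.mono (Set.subset_insert p π))
          (Or.inr ⟨p, Set.mem_insert p π, hq⟩)⟩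

/-! ### Rank, and finiteness modulo `p`-th powers. -/

/-- A group built from cyclic and quasicyclic groups has a numerical rank function on its
subgroups that detects whether a normal subgroup is of infinite torsion index in another. -/
theorem PolyClass.exists_rank {G : Type u} [Group G] {π : Set Nat.Primes}
    (hG : PolyClass (CyclicOrQuasicyclic π) G) :
    ∃ c : Subgroup G → ℕ, Monotone c ∧ ∀ H K : Subgroup G, H.Normal → H ≤ K → c K ≤ c H →
      ∀ k ∈ K, ∃ n, 0 < n ∧ k ^ n ∈ H := by
  classical
  induction hG with
  | triv G =>
    exact ⟨fun _ => 0, monotone_const, fun H K _ _ _ k _ =>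
      ⟨1, one_pos, by rw [Subsingleton.elim (k ^ 1) 1]; exact one_mem H⟩⟩
  | step G N _ hq ih =>
    obtain ⟨c, hc, hcr⟩ := ih
    obtain ⟨d, hd, hdr⟩ : ∃ c : Subgroup (G ⧸ N) → ℕ, Monotone c ∧ ∀ H K : Subgroup (G ⧸ N),
        H.Normal → H ≤ K → c K ≤ c H → ∀ k ∈ K, ∃ n, 0 < n ∧ k ^ n ∈ H := by
      -- The rank on a cyclic or quasicyclic group is `0` for torsion subgroups and `1` otherwise.
      refine ⟨fun H => if ∀ h ∈ H, IsOfFinOrder h then 0 else 1, fun H K hHK => ?_,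
        fun H K _ hHK hle k hk => ?_⟩
      · dsimp only
        split_ifs with h1 h2 h2
        · exact le_rfl
        · exact zero_le_one
        · exact absurd (fun h hh => h2 h (hHK hh)) h1
        · exact le_rfl
      · have htors : IsOfFinOrder k → ∃ n, 0 < n ∧ k ^ n ∈ H := fun h => by
          obtain ⟨n, hn, h⟩ := isOfFinOrder_iff_pow_eq_one.1 h
          exact ⟨n, hn, h ▸ one_mem H⟩
        rcases hq with hq | ⟨p, -, hq⟩
        · dsimp only at hle
          by_cases h1 : ∀ h ∈ K, IsOfFinOrder h
          · exact htors (h1 k hk)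
          · rw [if_neg h1] at hle
            have h2 : ¬ ∀ h ∈ H, IsOfFinOrder h := fun h2 => by
              rw [if_pos h2] at hle
              omega
            push Not at h2
            obtain ⟨h, hh, hinf⟩ := h2
            obtain ⟨g, hg⟩ := hq.exists_generator
            obtain ⟨i, rfl⟩ := Subgroup.mem_zpowers_iff.1 (hg h)
            obtain ⟨j, rfl⟩ := Subgroup.mem_zpowers_iff.1 (hg k)
            have hi : i ≠ 0 := by
              rintro rfl
              rw [zpow_zero] at hinf
              exact hinf IsOfFinOrder.one
            refine ⟨i.natAbs, Int.natAbs_pos.2 hi, ?_⟩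
            have hmem : (g ^ j) ^ i ∈ H := by
              rw [← zpow_mul, mul_comm, zpow_mul]
              exact zpow_mem hh j
            rcases Int.natAbs_eq i with h | h
            · rw [h, zpow_natCast] at hmem
              exact hmem
            · rw [h, zpow_neg, zpow_natCast] at hmem
              exact inv_mem_iff.1 hmem
        · obtain ⟨n, hn⟩ := hq.pow_eq_one k
          exact htors (isOfFinOrder_iff_pow_eq_one.2 ⟨_, pow_pos p.2.pos n, hn⟩)
    -- Ranks add along the extension. Both summands are monotone, so an inequality `c K ≤ c H`
    -- between the sums forces one between each pair of summands.
    refine ⟨fun H => c (H.subgroupOf N) + d (H.map (QuotientGroup.mk' N)), fun H K hHK =>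
      add_le_add (hc fun x hx => hHK hx) (hd (Subgroup.map_mono hHK)),
      fun H K hH hHK hle k hk => ?_⟩
    have h1 : c (H.subgroupOf N) ≤ c (K.subgroupOf N) := hc fun x hx => hHK hx
    have h2 : d (H.map (QuotientGroup.mk' N)) ≤ d (K.map (QuotientGroup.mk' N)) :=
      hd (Subgroup.map_mono hHK)
    dsimp only at hle
    obtain ⟨n, hn, hnH⟩ := hdr _ _ (hH.map _ (QuotientGroup.mk'_surjective N))
      (Subgroup.map_mono hHK) (by omega) _ (Subgroup.mem_map_of_mem (QuotientGroup.mk' N) hk)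
    obtain ⟨h, hh, hhk⟩ := hnH
    have hν : h⁻¹ * k ^ n ∈ N := by
      rw [← map_pow] at hhk
      exact QuotientGroup.eq.1 hhk
    obtain ⟨m, hm, hmH⟩ := hcr (H.subgroupOf N) (K.subgroupOf N) inferInstance
      (fun x hx => hHK hx) (by omega) ⟨h⁻¹ * k ^ n, hν⟩
      (mul_mem (inv_mem (hHK hh)) (pow_mem hk n))
    have hmH' : (h⁻¹ * k ^ n) ^ m ∈ H := hmH
    refine ⟨n * m, mul_pos hn hm, ?_⟩
    have hh : h ∈ H := hh
    rw [← QuotientGroup.eq_one_iff] at hmH' hh ⊢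
    rw [QuotientGroup.mk_pow, QuotientGroup.mk_mul, QuotientGroup.mk_inv, hh, inv_one, one_mul,
      QuotientGroup.mk_pow, ← pow_mul] at hmH'
    rwa [QuotientGroup.mk_pow]

/-- Residues modulo `p` suffice in a cyclic group, while a quasicyclic group is divisible by every
prime, including its own. -/
theorem CyclicOrQuasicyclic.finite_pow_cosets {π : Set Nat.Primes} {Q : Type u} [Group Q]
    (hQ : CyclicOrQuasicyclic π Q) {p : ℕ} (hp : p.Prime) :
    ∃ F : Set Q, F.Finite ∧ ∀ g, ∃ f ∈ F, ∃ h, g = f * h ^ p := by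
  rcases hQ with hQ | ⟨q, -, hQ⟩
  · obtain ⟨g, hg⟩ := hQ.exists_generator
    refine ⟨(fun i : ℕ => g ^ i) '' Set.Iio p, (Set.finite_Iio p).image _, fun y => ?_⟩
    obtain ⟨j, rfl⟩ := Subgroup.mem_zpowers_iff.1 (hg y)
    have hp0 : (0 : ℤ) < p := by exact_mod_cast hp.pos
    refine ⟨_, ⟨(j % p).toNat, ?_, rfl⟩, g ^ (j / p), ?_⟩
    · have := Int.emod_lt_of_pos j hp0
      have := Int.emod_nonneg j hp0.ne'
      rw [Set.mem_Iio]
      omega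
    · dsimp only
      rw [← zpow_natCast, ← zpow_natCast, ← zpow_mul, ← zpow_add,
        Int.toNat_of_nonneg (Int.emod_nonneg j hp0.ne'), mul_comm, Int.emod_add_mul_ediv]
  · refine ⟨{1}, Set.finite_singleton 1, fun y => ⟨1, rfl, ?_⟩⟩
    by_cases hqp : (q : ℕ) = p
    · obtain ⟨x, h0, -, hx, ht⟩ := hQ
      have hx' : IsRootSeq (q : ℕ) x := hx
      obtain ⟨n, hn⟩ := hx'.mem_zpowers_of_mem_closure (y := y) (ht ▸ Subgroup.mem_top _)
      obtain ⟨j, rfl⟩ := Subgroup.mem_zpowers_iff.1 hn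
      refine ⟨x (n + 1) ^ j, ?_⟩
      rw [one_mul, ← hqp, ← zpow_natCast, ← zpow_mul, mul_comm, zpow_mul, zpow_natCast, hx]
    · obtain ⟨n, hn⟩ := hQ.pow_eq_one y
      have hc : Nat.Coprime p ((q : ℕ) ^ n) :=
        Nat.Coprime.pow_right _ ((Nat.coprime_primes hp q.2).2 (Ne.symm hqp))
      obtain ⟨a, b, hab⟩ := (Nat.isCoprime_iff_coprime.2 hc)
      refine ⟨y ^ a, ?_⟩
      have h1 : y ^ (b * (((q : ℕ) ^ n : ℕ) : ℤ)) = 1 := by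
        rw [mul_comm, zpow_mul, zpow_natCast, hn, one_zpow]
      rw [one_mul, ← zpow_natCast, ← zpow_mul]
      calc y = y ^ (a * (p : ℤ) + b * (((q : ℕ) ^ n : ℕ) : ℤ)) := by rw [hab, zpow_one]
        _ = _ := by rw [zpow_add, h1, mul_one]

theorem PolyClass.finite_pow_cosets {G : Type u} [Group G] {π : Set Nat.Primes}
    (hG : PolyClass (CyclicOrQuasicyclic π) G) {p : ℕ} (hp : p.Prime)
    (hcomm : ∀ a b : G, a * b = b * a) :
    ∃ F : Set G, F.Finite ∧ ∀ g, ∃ f ∈ F, ∃ h, g = f * h ^ p := by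
  induction hG with
  | triv G => exact ⟨{1}, Set.finite_singleton 1, fun g => ⟨1, rfl, 1, Subsingleton.elim _ _⟩⟩
  | step G N _ hq ih =>
    obtain ⟨E, hE, hEc⟩ := ih fun a b => Subtype.ext (hcomm a b)
    obtain ⟨F, hF, hFc⟩ := hq.finite_pow_cosets hp
    refine ⟨Set.image2 (fun (f : G ⧸ N) (e : N) => Quotient.out f * (e : G)) F E, hF.image2 _ hE, fun g => ?_⟩
    obtain ⟨f, hf, h, hgf⟩ := hFc (g : G ⧸ N)
    obtain ⟨h, rfl⟩ := QuotientGroup.mk'_surjective N h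
    have hn : (Quotient.out f * h ^ p)⁻¹ * g ∈ N := by
      rw [← QuotientGroup.eq, hgf, QuotientGroup.mk_mul, QuotientGroup.out_eq',
        QuotientGroup.mk_pow]
      rfl
    obtain ⟨e, he, k, hk⟩ := hEc ⟨_, hn⟩
    refine ⟨_, ⟨f, hf, e, he, rfl⟩, h * k, ?_⟩
    have hk' : (Quotient.out f * h ^ p)⁻¹ * g = e * (k : G) ^ p := congrArg Subtype.val hk
    rw [inv_mul_eq_iff_eq_mul] at hk'
    have hcm : Commute h (k : G) := hcomm _ _
    rw [hk', hcm.mul_pow, mul_assoc, mul_assoc, ← mul_assoc (h ^ p), hcomm (h ^ p) e, mul_assoc]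

/-! ### Torsion relative to a subgroup, and the torsion radical. -/

/-- Every element of `M` has a positive power in `N`. -/
def IsTorsionOver {G : Type*} [Group G] (N M : Subgroup G) : Prop :=
  ∀ x ∈ M, ∃ n, 0 < n ∧ x ^ n ∈ N

/-- No normal subgroup outside `N` is torsion over `N`; for normal `N` this says that `G ⧸ N` has
no nontrivial normal torsion subgroup. -/
def IsRadicallyIsolated {G : Type*} [Group G] (N : Subgroup G) : Prop :=
  ∀ M : Subgroup G, M.Normal → IsTorsionOver N M → M ≤ N

namespace IsTorsionOver

variable {G : Type*} [Group G] {N M K : Subgroup G}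

theorem trans (h₁ : IsTorsionOver N M) (h₂ : IsTorsionOver M K) : IsTorsionOver N K := by
  intro x hx
  obtain ⟨n, hn, h⟩ := h₂ x hx
  obtain ⟨m, hm, h⟩ := h₁ _ h
  exact ⟨n * m, mul_pos hn hm, by rwa [pow_mul]⟩

theorem mono {N' M' : Subgroup G} (h : IsTorsionOver N M) (hN : N ≤ N') (hM : M' ≤ M) :
    IsTorsionOver N' M' := fun x hx =>
  (h x (hM hx)).imp fun _ hn => ⟨hn.1, hN hn.2⟩

theorem sup (hM : IsTorsionOver N M) (hK : IsTorsionOver N K) [N.Normal] [K.Normal] :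
    IsTorsionOver N (M ⊔ K) := by
  intro x hx
  obtain ⟨a, ha, b, hb, rfl⟩ := Subgroup.mem_sup_of_normal_right.1 hx
  obtain ⟨m, hm, haN⟩ := hM a ha
  have hk : (a ^ m)⁻¹ * (a * b) ^ m ∈ K := by
    rw [← QuotientGroup.eq, QuotientGroup.mk_pow, QuotientGroup.mk_pow, QuotientGroup.mk_mul,
      (QuotientGroup.eq_one_iff b).2 hb, mul_one]
  obtain ⟨n, hn, hkN⟩ := hK _ hk
  refine ⟨m * n, mul_pos hm hn, ?_⟩
  rw [← QuotientGroup.eq_one_iff] at haN hkN ⊢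
  rwa [QuotientGroup.mk_pow, QuotientGroup.mk_mul, QuotientGroup.mk_inv, haN, inv_one, one_mul,
    QuotientGroup.mk_pow, ← pow_mul] at hkN

theorem of_le (h : M ≤ N) : IsTorsionOver N M := fun x hx => ⟨1, one_pos, by
  rw [pow_one]
  exact h hx⟩

end IsTorsionOver

/-- The preimage of the torsion radical of `G ⧸ N`. -/
theorem exists_torsionRadical {G : Type*} [Group G] (N : Subgroup G) [N.Normal] :
    ∃ T : Subgroup G, T.Normal ∧ N ≤ T ∧ IsTorsionOver N T ∧ IsRadicallyIsolated T := by
  let T : Subgroup G :=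
    -- Elements of finite order modulo `N` need not form a subgroup; asking for the whole normal
    -- closure to be torsion over `N` repairs this through `IsTorsionOver.sup`.
    { carrier := {x | IsTorsionOver N (Subgroup.normalClosure {x})}
      one_mem' := by
        refine IsTorsionOver.of_le (Subgroup.normalClosure_le_normal ?_)
        rintro _ rfl
        exact one_mem N
      mul_mem' := by
        intro a b ha hb
        refine (IsTorsionOver.sup ha hb).mono le_rfl (Subgroup.normalClosure_le_normal ?_)
        rintro _ rfl
        exact Subgroup.mul_mem_sup (Subgroup.subset_normalClosure rfl)
          (Subgroup.subset_normalClosure rfl)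
      inv_mem' := by
        intro a ha
        refine IsTorsionOver.mono ha le_rfl (Subgroup.normalClosure_le_normal ?_)
        rintro _ rfl
        exact inv_mem (Subgroup.subset_normalClosure rfl) }
  have hmem : ∀ {M : Subgroup G}, M.Normal → IsTorsionOver N M → M ≤ T := fun hM h x hx =>
    h.mono le_rfl (Subgroup.normalClosure_le_normal (by rintro _ rfl; exact hx))
  have hT : IsTorsionOver N T := fun x hx => hx x (Subgroup.subset_normalClosure rfl)
  refine ⟨T, ⟨fun x hx g => ?_⟩, hmem inferInstance (IsTorsionOver.of_le le_rfl), hT,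
    fun M hM h => hmem hM (hT.trans h)⟩
  refine IsTorsionOver.mono (N := N) hx le_rfl (Subgroup.normalClosure_le_normal ?_)
  rintro _ rfl
  exact (Subgroup.normalClosure_normal (s := {x})).conj_mem x
    (Subgroup.subset_normalClosure rfl) g

theorem IsRadicallyIsolated.bot_quotient {G : Type*} [Group G] {T : Subgroup G} [T.Normal]
    (hT : IsRadicallyIsolated T) : IsRadicallyIsolated (⊥ : Subgroup (G ⧸ T)) := by
  intro M hM h
  have hle := hT (M.comap (QuotientGroup.mk' T)) inferInstance fun x hx => by
    obtain ⟨n, hn, h'⟩ := h _ hx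
    exact ⟨n, hn, (QuotientGroup.eq_one_iff _).1 h'⟩
  intro y hy
  obtain ⟨x, rfl⟩ := QuotientGroup.mk'_surjective T y
  exact (QuotientGroup.eq_one_iff x).2 (hle hy)

/-! ### Torsion in solvable groups that are torsion modulo the center. -/

theorem finite_of_fg_isMulTorsion_of_derivedSeries {n : ℕ} : ∀ {G : Type u} [Group G],
    derivedSeries G n = ⊥ → Group.FG G → IsMulTorsion G → Finite G := by
  induction n with
  | zero =>
    intro G _ h _ _
    rw [derivedSeries_zero] at h
    have : Subsingleton G := Subgroup.subsingleton_iff.1 (subsingleton_of_bot_eq_top h.symm)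
    infer_instance
  | succ n ih =>
    intro G _ h hfg ht
    have hq : Finite (G ⧸ derivedSeries G n) :=
      ih (derivedSeries_eq_bot_of_surjective (QuotientGroup.mk'_surjective _)
        (QuotientGroup.ker_mk' _).ge) inferInstance
        (ht.of_surjective (QuotientGroup.mk'_surjective _))
    have hfi : (derivedSeries G n).FiniteIndex := Subgroup.finiteIndex_of_finite_quotient
    have hfgD : Group.FG (derivedSeries G n) := inferInstance
    have hfD : Finite (derivedSeries G n) := by
      let _ : CommGroup (derivedSeries G n) :=
        { (inferInstance : Group (derivedSeries G n)) with
          mul_comm := fun a b => Subtype.ext (commute_of_derivedSeries_succ_eq_bot h a.2 b.2) }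
      exact CommGroup.finite_of_fg_isMulTorsion _ (ht.subgroup _)
    exact Finite.of_equiv _ (Subgroup.groupEquivQuotientProdSubgroup (s := derivedSeries G n)).symm

/-- In a solvable group that is torsion modulo a central subgroup, the elements of finite order
are closed under products (a consequence of Schur's theorem on central subgroups of finite
index). -/
theorem isOfFinOrder_mul_of_isTorsionOver_center {G : Type u} [Group G]
    (hs : Group.IsSolvable G) (hG : IsTorsionOver (Subgroup.center G) ⊤) {x y : G}
    (hx : IsOfFinOrder x) (hy : IsOfFinOrder y) : IsOfFinOrder (x * y) := by
  -- In the finitely generated case the center has finite index, and raising to that index is the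
  -- transfer homomorphism into the abelian center. The general case restricts to `⟨x, y⟩`.
  have key : ∀ (D : Type u) [Group D] (x y : D), Group.IsSolvable D → Group.FG D →
      IsTorsionOver (Subgroup.center D) ⊤ → IsOfFinOrder x → IsOfFinOrder y →
      IsOfFinOrder (x * y) := by
    intro D _ x y hs hfg hD hx hy
    obtain ⟨n, hn⟩ := (Group.isSolvable_def (D ⧸ Subgroup.center D)).1 inferInstance
    have hfin : Finite (D ⧸ Subgroup.center D) :=
      finite_of_fg_isMulTorsion_of_derivedSeries hn inferInstance fun g => by
        obtain ⟨g, rfl⟩ := QuotientGroup.mk'_surjective _ g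
        obtain ⟨m, hm, hg⟩ := hD g trivial
        exact isOfFinOrder_iff_pow_eq_one.2 ⟨m, hm, (QuotientGroup.eq_one_iff _).2 hg⟩
    have hfi : (Subgroup.center D).FiniteIndex := Subgroup.finiteIndex_of_finite_quotient
    let f := MonoidHom.transferCenterPow D
    have h1 : IsOfFinOrder (f (x * y)) := by
      rw [map_mul]
      have hcm : Commute (f x) (f y) := Subtype.ext (Subgroup.mem_center_iff.1 (f y).2 (f x))
      exact hcm.isOfFinOrder_mul (f.isOfFinOrder hx) (f.isOfFinOrder hy)
    have h2 : IsOfFinOrder ((x * y) ^ (Subgroup.center D).index) := by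
      have := (Subgroup.center D).subtype.isOfFinOrder h1
      rwa [Subgroup.subtype_apply, MonoidHom.transferCenterPow_apply] at this
    exact (isOfFinOrder_pow.1 h2).resolve_right hfi.index_ne_zero
  have hxD : x ∈ Subgroup.closure {x, y} := Subgroup.subset_closure (by simp)
  have hyD : y ∈ Subgroup.closure {x, y} := Subgroup.subset_closure (by simp)
  have hDt : IsTorsionOver (Subgroup.center (Subgroup.closure {x, y})) ⊤ := by
    intro g _
    obtain ⟨n, hn, h⟩ := hG g trivial
    refine ⟨n, hn, Subgroup.mem_center_iff.2 fun z => Subtype.ext ?_⟩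
    exact Subgroup.mem_center_iff.1 h z
  have := key (Subgroup.closure {x, y}) ⟨x, hxD⟩ ⟨y, hyD⟩ inferInstance inferInstance hDt
    (Submonoid.isOfFinOrder_coe.1 hx) (Submonoid.isOfFinOrder_coe.1 hy)
  exact Submonoid.isOfFinOrder_coe.2 this

/-! ### Automorphisms of finite order of torsion-free abelian groups. -/

section Automorphisms

variable {A : Type*} [CommGroup A]

theorem IsTorsionFreeGroup.pow_injective (hA : IsTorsionFreeGroup A) {n : ℕ} (hn : 0 < n) {a b : A}
    (h : a ^ n = b ^ n) : a = b := by
  have := hA (a / b) (isOfFinOrder_iff_pow_eq_one.2 ⟨n, hn, by rw [div_pow, h, div_self']⟩)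
  exact div_eq_one.1 this

theorem MulAut.exists_pow_apply_eq {φ : MulAut A} {p : ℕ}
    (hφ : ∀ a, ∃ b, φ a = a * b ^ p) {a b : A} {m : ℕ} (hab : φ a = a * b ^ m) (j : ℕ) :
    ∃ d, (φ ^ j) a = a * (b ^ j * d ^ p) ^ m := by
  obtain ⟨c, hc⟩ := hφ b
  induction j with
  | zero => exact ⟨1, by simp⟩
  | succ j ih =>
    obtain ⟨d, hd⟩ := ih
    refine ⟨c ^ j * φ d, ?_⟩
    rw [pow_succ', MulAut.mul_apply, hd, map_mul, hab, map_pow, map_mul, map_pow, map_pow, hc,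
      mul_assoc, ← mul_pow]
    congr 2
    rw [mul_pow, mul_pow, ← pow_mul, ← pow_mul, mul_comm p j, pow_succ']
    simp only [mul_assoc]

/-- An automorphism of order prime to `p` of a torsion-free abelian group without elements of
infinite `p`-height is trivial if it is trivial modulo `p`-th powers. -/
theorem MulAut.eq_one_of_pow_eq_one_of_coprime (hA : IsTorsionFreeGroup A) {φ : MulAut A} {p q : ℕ}
    (hp : 0 < p) (hpq : Nat.Coprime q p) (hφ : ∀ a, ∃ b, φ a = a * b ^ p)
    (hres : ∀ a : A, (∀ k, ∃ b, b ^ p ^ k = a) → a = 1) (hq : φ ^ q = 1) : φ = 1 := by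
  -- Triviality modulo `p ^ k`-th powers improves to `p ^ (k + 1)`: expanding `φ ^ q = 1` gives `b ^
  -- q * d ^ p = 1`, and `q` prime to `p` makes `b` itself a `p`-th power.
  have key : ∀ k, ∀ a, ∃ b, φ a = a * b ^ p ^ k := by
    intro k
    induction k with
    | zero => exact fun a => ⟨a⁻¹ * φ a, by simp⟩
    | succ k ih =>
      intro a
      obtain ⟨b, hb⟩ := ih a
      obtain ⟨d, hd⟩ := MulAut.exists_pow_apply_eq hφ hb q
      rw [hq, MulAut.one_apply, left_eq_mul] at hd
      have hd' : b ^ q * d ^ p = 1 :=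
        hA _ (isOfFinOrder_iff_pow_eq_one.2 ⟨_, pow_pos hp k, hd⟩)
      obtain ⟨u, v, huv⟩ := Nat.isCoprime_iff_coprime.2 hpq
      refine ⟨d⁻¹ ^ u * b ^ v, ?_⟩
      have hbe : b = (d⁻¹ ^ u * b ^ v) ^ p := by
        calc b = b ^ (u * (q : ℤ) + v * (p : ℤ)) := by rw [huv, zpow_one]
          _ = (b ^ q) ^ u * (b ^ v) ^ p := by
            rw [zpow_add, mul_comm u, zpow_mul, zpow_natCast, zpow_mul, zpow_natCast]
          _ = _ := by
            rw [eq_inv_of_mul_eq_one_left hd', mul_pow, ← inv_pow]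
            congr 1
            rw [← zpow_natCast, ← zpow_natCast, ← zpow_mul, ← zpow_mul, mul_comm]
      rw [hb]
      congr 1
      conv_lhs => rw [hbe]
      rw [← pow_mul, ← pow_succ']
  ext a
  have := hres (a⁻¹ * φ a) fun k => by
    obtain ⟨b, hb⟩ := key k a
    exact ⟨b, by rw [hb, inv_mul_cancel_left]⟩
  exact (inv_mul_eq_one.1 this).symm

/-- Prime factors `q` of `n` are removed one at a time. Each `q` differs from at least one of `p`,
`p'`, and the coprime case applies there; this is why two primes are needed. -/
theorem MulAut.eq_one_of_pow_eq_one (hA : IsTorsionFreeGroup A) {φ : MulAut A} {p p' : ℕ}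
    (hp : p.Prime) (hp' : p'.Prime) (hne : p ≠ p')
    (hφ : ∀ a, ∃ b, φ a = a * b ^ p) (hφ' : ∀ a, ∃ b, φ a = a * b ^ p')
    (hres : ∀ a : A, (∀ k, ∃ b, b ^ p ^ k = a) → a = 1)
    (hres' : ∀ a : A, (∀ k, ∃ b, b ^ p' ^ k = a) → a = 1) {n : ℕ} (hn : 0 < n)
    (h : φ ^ n = 1) : φ = 1 := by
  have hpow : ∀ {r : ℕ}, (∀ a, ∃ b, φ a = a * b ^ r) → ∀ m a, ∃ b, (φ ^ m) a = a * b ^ r := by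
    intro r hr m
    induction m with
    | zero => exact fun a => ⟨1, by simp⟩
    | succ m ih =>
      intro a
      obtain ⟨b, hb⟩ := ih a
      obtain ⟨c, hc⟩ := hr (a * b ^ r)
      exact ⟨b * c, by rw [pow_succ', MulAut.mul_apply, hb, hc, mul_assoc, mul_pow]⟩
  induction n using Nat.strong_induction_on with
  | _ n ih =>
    by_cases h1 : n = 1
    · rwa [h1, pow_one] at h
    have hq := Nat.minFac_prime h1
    obtain ⟨m, hm⟩ := Nat.minFac_dvd n
    generalize n.minFac = q at hq hm
    have hm0 : 0 < m := by
      rcases Nat.eq_zero_or_pos m with h | h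
      · rw [h, mul_zero] at hm
        omega
      · exact h
    have hlt : m < n := by
      rw [hm]
      exact lt_mul_of_one_lt_left hm0 hq.one_lt
    refine ih m hlt hm0 ?_
    rw [hm, mul_comm, pow_mul] at h
    by_cases hqp : q = p
    · exact MulAut.eq_one_of_pow_eq_one_of_coprime hA hp'.pos
        ((Nat.coprime_primes hq hp').2 (hqp ▸ hne)) (hpow hφ' m) hres' h
    · exact MulAut.eq_one_of_pow_eq_one_of_coprime hA hp.pos
        ((Nat.coprime_primes hq hp).2 hqp) (hpow hφ m) hres h

end Automorphisms

/-- Roots are unique in a torsion-free abelian group, so the `p ^ k`-th roots of `a` form a root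
sequence; it has bounded exponent and is therefore trivial. -/
theorem PolyClass.eq_one_of_forall_exists_pow {A : Type u} [CommGroup A] {π : Set Nat.Primes}
    (hA : PolyClass (CyclicOrQuasicyclic π) A) (ht : IsTorsionFreeGroup A) {p : Nat.Primes}
    (hp : p ∉ π) {a : A} (h : ∀ k, ∃ b, b ^ (p : ℕ) ^ k = a) : a = 1 := by
  choose y hy using h
  have hroot : IsRootSeq (p : ℕ) y := fun n =>
    ht.pow_injective (pow_pos p.2.pos n) (by rw [← pow_mul, ← pow_succ', hy, hy])
  obtain ⟨m, hm, h⟩ := hA.exists_pow_eq_one hp hroot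
  rw [← hy 0, pow_zero, pow_one]
  exact ht _ (isOfFinOrder_iff_pow_eq_one.2 ⟨m, hm, h 0⟩)

/-- The elements acting trivially on an abelian normal subgroup modulo `p`-th powers form a
subgroup of finite index. -/
theorem exists_finiteIndex_conj_eq_mul_pow {G : Type*} [Group G] (A : Subgroup G) [A.Normal]
    (hcomm : ∀ a b : A, a * b = b * a) {p : ℕ}
    (hfin : ∃ F : Set A, F.Finite ∧ ∀ g, ∃ f ∈ F, ∃ h, g = f * h ^ p) :
    ∃ K : Subgroup G, K.FiniteIndex ∧
      ∀ g ∈ K, ∀ a : A, ∃ b, MulAut.conjNormal g a = a * b ^ p := by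
  let B : Subgroup G :=
    { carrier := {x | ∃ a : A, ((a ^ p : A) : G) = x}
      one_mem' := ⟨1, by simp⟩
      mul_mem' := by
        rintro _ _ ⟨a, rfl⟩ ⟨b, rfl⟩
        have hab : Commute a b := hcomm a b
        exact ⟨a * b, by rw [hab.mul_pow, Subgroup.coe_mul]⟩
      inv_mem' := by
        rintro _ ⟨a, rfl⟩
        exact ⟨a⁻¹, by rw [inv_pow, Subgroup.coe_inv]⟩ }
  have hB : B.Normal := ⟨by
    rintro _ ⟨a, rfl⟩ g
    refine ⟨MulAut.conjNormal g a, ?_⟩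
    rw [← map_pow, MulAut.conjNormal_apply]⟩
  have hA' : (A.map (QuotientGroup.mk' B)).Normal :=
    Subgroup.Normal.map inferInstance _ (QuotientGroup.mk'_surjective B)
  have hAf : Finite (A.map (QuotientGroup.mk' B)) := by
    obtain ⟨F, hF, hFc⟩ := hfin
    refine (hF.image fun f : A => QuotientGroup.mk' B f).subset ?_
    rintro _ ⟨a, ha, rfl⟩
    obtain ⟨f, hf, h, hfh⟩ := hFc ⟨a, ha⟩
    refine ⟨f, hf, QuotientGroup.eq.2 ⟨h, ?_⟩⟩
    have : a = f * ((h ^ p : A) : G) := congrArg Subtype.val hfh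
    rw [this, inv_mul_cancel_left]
  -- The action on the finite group of `A` modulo `p`-th powers has finite automorphism group as
  -- target, so its kernel has finite index.
  let f : G →* MulAut (A.map (QuotientGroup.mk' B)) :=
    MulAut.conjNormal.comp (QuotientGroup.mk' B)
  have hMf : Finite (MulAut (A.map (QuotientGroup.mk' B))) :=
    Finite.of_injective (fun e : MulAut (A.map (QuotientGroup.mk' B)) =>
      (e : A.map (QuotientGroup.mk' B) → A.map (QuotientGroup.mk' B))) DFunLike.coe_injective
  refine ⟨f.ker, inferInstance, fun g hg a => ?_⟩
  have h1 := DFunLike.congr_fun (MonoidHom.mem_ker.1 hg)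
    ⟨QuotientGroup.mk' B a, Subgroup.mem_map_of_mem _ a.2⟩
  have h2 : QuotientGroup.mk' B (g * a * g⁻¹) = QuotientGroup.mk' B a := by
    rw [map_mul, map_mul, map_inv]
    exact congrArg Subtype.val h1
  obtain ⟨b, hb⟩ := QuotientGroup.eq.1 h2.symm
  refine ⟨b, Subtype.ext ?_⟩
  rw [Subgroup.coe_mul, hb, MulAut.conjNormal_apply, mul_inv_cancel_left]

/-! ### Virtual torsion-freeness. -/

theorem IsRadicallyIsolated.eq_one_of_isOfFinOrder {G : Type*} [Group G]
    (hG : IsRadicallyIsolated (⊥ : Subgroup G)) {C : Subgroup G} (hC : C.Normal)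
    (hmul : ∀ x ∈ C, ∀ y ∈ C, IsOfFinOrder x → IsOfFinOrder y → IsOfFinOrder (x * y)) {x : G}
    (hx : x ∈ C) (ht : IsOfFinOrder x) : x = 1 := by
  let M : Subgroup G :=
    { carrier := {x | x ∈ C ∧ IsOfFinOrder x}
      one_mem' := ⟨one_mem C, IsOfFinOrder.one⟩
      mul_mem' := fun ha hb => ⟨mul_mem ha.1 hb.1, hmul _ ha.1 _ hb.1 ha.2 hb.2⟩
      inv_mem' := fun ha => ⟨inv_mem ha.1, ha.2.inv⟩ }
  have hM : M.Normal := ⟨fun x hx g =>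
    ⟨hC.conj_mem x hx.1 g, (MulAut.conj g).toMonoidHom.isOfFinOrder hx.2⟩⟩
  have := hG M hM fun x hx => by
    obtain ⟨n, hn, h⟩ := isOfFinOrder_iff_pow_eq_one.1 hx.2
    exact ⟨n, hn, h⟩
  exact this ⟨hx, ht⟩

/-- A solvable group built from cyclic and quasicyclic groups without nontrivial normal torsion
subgroups is virtually torsion-free. -/
theorem isVirtuallyTorsionFree_of_isRadicallyIsolated_bot {n : ℕ} :
    ∀ {G : Type u} [Group G], derivedSeries G n = ⊥ →
      PolyClass (CyclicOrQuasicyclic Set.univ) G → IsRadicallyIsolated (⊥ : Subgroup G) →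
      IsVirtuallyTorsionFree G := by
  induction n with
  | zero =>
    intro G _ h _ _
    rw [derivedSeries_zero] at h
    have : Subsingleton G := Subgroup.subsingleton_iff.1 (subsingleton_of_bot_eq_top h.symm)
    exact ⟨⊤, inferInstance, fun g _ => Subsingleton.elim _ _⟩
  | succ n ih =>
    intro G _ h hG hiso
    have hs : Group.IsSolvable G := (Group.isSolvable_def G).2 ⟨_, h⟩
    set A := derivedSeries G n with hAdef
    have hcomm : ∀ a b : A, a * b = b * a := fun a b =>
      Subtype.ext (commute_of_derivedSeries_succ_eq_bot h a.2 b.2)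
    have hAt : ∀ {x : G}, x ∈ A → IsOfFinOrder x → x = 1 := fun hx ht =>
      hiso.eq_one_of_isOfFinOrder (C := A) inferInstance (fun x hx y hy hxt hyt =>
        (show Commute x y from commute_of_derivedSeries_succ_eq_bot h hx hy).isOfFinOrder_mul
          hxt hyt) hx ht
    obtain ⟨T, hT, hAT, hTA, hTiso⟩ := exists_torsionRadical A
    obtain ⟨L, hL, hLt⟩ := ih (G := G ⧸ T)
      (derivedSeries_eq_bot_of_surjective (QuotientGroup.mk'_surjective T)
        (by rwa [QuotientGroup.ker_mk']))
      (hG.of_surjective (CyclicOrQuasicyclic.quotClosed _) (QuotientGroup.mk' T)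
        (QuotientGroup.mk'_surjective T)) hTiso.bot_quotient
    obtain ⟨π, hπ, hGπ⟩ := hG.exists_finite_primes
    have hAπ : PolyClass (CyclicOrQuasicyclic π) A :=
      hGπ.of_injective (CyclicOrQuasicyclic.subClosed _) A.subtype A.subtype_injective
    obtain ⟨p, hp⟩ := hπ.infinite_compl.nonempty
    obtain ⟨q, hq⟩ := (hπ.insert p).infinite_compl.nonempty
    have hpq : (p : ℕ) ≠ q := fun h => hq (Or.inl (Subtype.ext h.symm))
    have hqπ : q ∉ π := fun h => hq (Or.inr h)
    obtain ⟨K, hK, hKp⟩ := exists_finiteIndex_conj_eq_mul_pow A hcomm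
      (hAπ.finite_pow_cosets p.2 hcomm)
    obtain ⟨K', hK', hKq⟩ := exists_finiteIndex_conj_eq_mul_pow A hcomm
      (hAπ.finite_pow_cosets q.2 hcomm)
    have hLc : (L.comap (QuotientGroup.mk' T)).FiniteIndex := ⟨by
      rw [Subgroup.index_comap_of_surjective L (QuotientGroup.mk'_surjective T)]
      exact hL.index_ne_zero⟩
    refine ⟨L.comap (QuotientGroup.mk' T) ⊓ (K ⊓ K'), inferInstance, ?_⟩
    rintro ⟨x, hxL, hxK, hxK'⟩ hxt
    have hxt : IsOfFinOrder x := Submonoid.isOfFinOrder_coe.2 hxt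
    refine Subtype.ext ?_
    have hxT : x ∈ T := by
      have := hLt ⟨_, hxL⟩ (Submonoid.isOfFinOrder_coe.1
        ((QuotientGroup.mk' T).isOfFinOrder hxt))
      exact (QuotientGroup.eq_one_iff x).1 (congrArg Subtype.val this)
    obtain ⟨m, hm, hxA⟩ := hTA x hxT
    -- Conjugation by `x` has finite order on `A`, because `x ^ m` lies in the abelian group `A`.
    have hφ : (MulAut.conjNormal x : MulAut A) = 1 := by
      let _ : CommGroup A := { (inferInstance : Group A) with mul_comm := hcomm }
      have htf : IsTorsionFreeGroup A := fun a ha =>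
        Subtype.ext (hAt a.2 (Submonoid.isOfFinOrder_coe.2 ha))
      refine MulAut.eq_one_of_pow_eq_one htf p.2 q.2 hpq (hKp x hxK) (hKq x hxK')
        (fun a => hAπ.eq_one_of_forall_exists_pow htf hp)
        (fun a => hAπ.eq_one_of_forall_exists_pow htf hqπ) hm ?_
      rw [← map_pow]
      ext a
      rw [MulAut.conjNormal_apply, MulAut.one_apply, mul_inv_eq_iff_eq_mul]
      exact commute_of_derivedSeries_succ_eq_bot h hxA a.2
    have hxC : x ∈ T ⊓ Subgroup.centralizer A := by
      refine ⟨hxT, Subgroup.mem_centralizer_iff.2 fun a ha => ?_⟩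
      have := congrArg Subtype.val (DFunLike.congr_fun hφ ⟨a, ha⟩)
      rw [MulAut.conjNormal_apply, MulAut.one_apply, mul_inv_eq_iff_eq_mul] at this
      exact this.symm
    refine hiso.eq_one_of_isOfFinOrder (C := T ⊓ Subgroup.centralizer A) inferInstance
      (fun u hu v hv hut hvt => ?_) hxC hxt
    -- An element of `T` has a power in `A`, and everything in `T ⊓ centralizer A` commutes with
    -- that power.
    have hcen : IsTorsionOver
        (Subgroup.center ((T ⊓ Subgroup.centralizer A : Subgroup G) : Subgroup G)) ⊤ := by
      intro g _
      obtain ⟨k, hk, hgA⟩ := hTA g g.2.1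
      refine ⟨k, hk, Subgroup.mem_center_iff.2 fun z => Subtype.ext ?_⟩
      exact (Subgroup.mem_centralizer_iff.1 z.2.2 _ hgA).symm
    have := isOfFinOrder_mul_of_isTorsionOver_center inferInstance hcen
      (x := ⟨u, hu⟩) (y := ⟨v, hv⟩) (Submonoid.isOfFinOrder_coe.1 hut)
      (Submonoid.isOfFinOrder_coe.1 hvt)
    exact Submonoid.isOfFinOrder_coe.2 this

/-! ### Isolated kernels and the radical. -/

/-- `L` is the kernel of a homomorphism to a group built from cyclic groups and quasicyclic groups
for primes in `π`, and `G ⧸ L` has no nontrivial normal torsion subgroup. -/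
structure IsIsolatedKernel (π : Set Nat.Primes) {G : Type u} [Group G] (L : Subgroup G) :
    Prop where
  exists_hom : ∃ (H : Type u) (_ : Group H) (f : G →* H),
    PolyClass (CyclicOrQuasicyclic π) H ∧ f.ker = L
  isolated : IsRadicallyIsolated L

namespace IsIsolatedKernel

variable {π : Set Nat.Primes} {G : Type u} [Group G] {L L' : Subgroup G}

theorem normal (h : IsIsolatedKernel π L) : L.Normal := by
  obtain ⟨⟨H, _, f, -, rfl⟩, -⟩ := h
  infer_instance

theorem polyClass_quotient [L.Normal] (h : IsIsolatedKernel π L) :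
    PolyClass (CyclicOrQuasicyclic π) (G ⧸ L) := by
  obtain ⟨⟨H, _, f, hH, rfl⟩, -⟩ := h
  exact hH.of_injective (CyclicOrQuasicyclic.subClosed _) (QuotientGroup.kerLift f)
    (QuotientGroup.kerLift_injective f)

theorem of_quotient [L.Normal] (h : PolyClass (CyclicOrQuasicyclic π) (G ⧸ L))
    (hL : IsRadicallyIsolated L) : IsIsolatedKernel π L :=
  ⟨⟨G ⧸ L, inferInstance, QuotientGroup.mk' L, h, QuotientGroup.ker_mk' L⟩, hL⟩

theorem top : IsIsolatedKernel π (⊤ : Subgroup G) := by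
  have : Subsingleton (G ⧸ (⊤ : Subgroup G)) := QuotientGroup.subsingleton_quotient_top
  exact of_quotient (.triv _) fun _ _ _ => le_top

theorem inf (h : IsIsolatedKernel π L) (h' : IsIsolatedKernel π L') :
    IsIsolatedKernel π (L ⊓ L') := by
  have hL := h.normal
  have hL' := h'.normal
  refine of_quotient ?_ fun M hM hMt => le_inf
    (h.isolated M hM (hMt.mono inf_le_left le_rfl))
    (h'.isolated M hM (hMt.mono inf_le_right le_rfl))
  refine PolyClass.of_ker_inf_ker (CyclicOrQuasicyclic.subClosed _) h.polyClass_quotient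
    h'.polyClass_quotient
    (QuotientGroup.map (L ⊓ L') L (MonoidHom.id G) inf_le_left)
    (QuotientGroup.map (L ⊓ L') L' (MonoidHom.id G) inf_le_right) fun x h1 h2 => ?_
  obtain ⟨x, rfl⟩ := QuotientGroup.mk'_surjective _ x
  exact (QuotientGroup.eq_one_iff x).2
    ⟨(QuotientGroup.eq_one_iff x).1 h1, (QuotientGroup.eq_one_iff x).1 h2⟩

theorem comap (h : IsIsolatedKernel π L) (φ : MulAut G) :
    IsIsolatedKernel π (L.comap φ.toMonoidHom) := by
  refine ⟨?_, fun M hM hMt => ?_⟩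
  · obtain ⟨⟨H, _, f, hH, rfl⟩, -⟩ := h
    exact ⟨H, inferInstance, f.comp φ.toMonoidHom, hH, rfl⟩
  · rw [← Subgroup.map_le_iff_le_comap]
    refine h.isolated _ (hM.map _ φ.surjective) ?_
    rintro _ ⟨x, hx, rfl⟩
    obtain ⟨n, hn, h⟩ := hMt x hx
    refine ⟨n, hn, ?_⟩
    rw [← map_pow]
    exact h

/-- Isolated kernels are transitive along normal inclusions. -/
theorem map_subtype (h : IsIsolatedKernel π L) {M : Subgroup L} (hM : IsIsolatedKernel π M)
    (hn : (M.map L.subtype).Normal) : IsIsolatedKernel π (M.map L.subtype) := by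
  have hL := h.normal
  have hMn := hM.normal
  have hle : M.map L.subtype ≤ L := Subgroup.map_subtype_le M
  refine of_quotient ?_ fun N hN hNt => ?_
  · refine h.polyClass_quotient.of_ker (CyclicOrQuasicyclic.subClosed _)
      (QuotientGroup.map _ L (MonoidHom.id G) hle) ?_
    let g : L →* (QuotientGroup.map (M.map L.subtype) L (MonoidHom.id G) hle).ker :=
      ((QuotientGroup.mk' (M.map L.subtype)).comp L.subtype).codRestrict _ fun x =>
        (QuotientGroup.eq_one_iff (x : G)).2 x.2
    refine hM.polyClass_quotient.of_surjective (CyclicOrQuasicyclic.quotClosed _)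
      (QuotientGroup.lift M g fun x hx => Subtype.ext ?_) ?_
    · exact (QuotientGroup.eq_one_iff (x : G)).2 (Subgroup.mem_map_of_mem _ hx)
    · rintro ⟨y, hy⟩
      obtain ⟨x, rfl⟩ := QuotientGroup.mk'_surjective _ y
      have hx : x ∈ L := (QuotientGroup.eq_one_iff x).1 hy
      exact ⟨((⟨x, hx⟩ : L) : L ⧸ M), rfl⟩
  · have hNL : N ≤ L := h.isolated N hN (hNt.mono hle le_rfl)
    have := hM.isolated (N.subgroupOf L) inferInstance fun x hx => by
      obtain ⟨n, hn, y, hy, hxy⟩ := hNt x hx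
      refine ⟨n, hn, ?_⟩
      have : y = x ^ n := Subtype.ext hxy
      rwa [← this]
    exact fun x hx => ⟨⟨x, hNL hx⟩, this hx, rfl⟩

/-- Take `L` of minimal rank. Its intersection with `L'` has no smaller rank, so `L` is torsion over
`L ⊓ L'`, and isolation of `L'` gives `L ≤ L'`. -/
theorem exists_least (hG : PolyClass (CyclicOrQuasicyclic Set.univ) G) :
    ∃ L : Subgroup G, IsIsolatedKernel π L ∧ ∀ L', IsIsolatedKernel π L' → L ≤ L' := by
  obtain ⟨c, hc, hcr⟩ := hG.exists_rank
  obtain ⟨L, hL, hmin⟩ := (measure c).wf.has_min {L | IsIsolatedKernel π L} ⟨⊤, top⟩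
  refine ⟨L, hL, fun L' hL' => ?_⟩
  have hLn := hL.normal
  have hLn' := hL'.normal
  have ht : IsTorsionOver (L ⊓ L') L := hcr (L ⊓ L') L inferInstance inf_le_left
    (not_lt.1 (hmin _ (hL.inf hL')))
  exact hL'.isolated L hLn (ht.mono inf_le_right le_rfl)

end IsIsolatedKernel

theorem isXGroup_of_least {π : Set Nat.Primes} {G : Type u} [Group G]
    (hG : PolyClass (CyclicOrQuasicyclic Set.univ) G) {L : Subgroup G}
    (hL : IsIsolatedKernel π L) (hmin : ∀ L', IsIsolatedKernel π L' → L ≤ L') :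
    IsXGroup π L := by
  intro N _ hN
  have hLn := hL.normal
  obtain ⟨M, hM, hMmin⟩ := IsIsolatedKernel.exists_least (π := π)
    (hG.of_injective (CyclicOrQuasicyclic.subClosed _) L.subtype L.subtype_injective)
  -- Conjugation by `g` carries isolated kernels of `L` to isolated kernels, so it preserves the
  -- least one.
  have hMn : (M.map L.subtype).Normal := ⟨by
    rintro _ ⟨m, hm, rfl⟩ g
    exact ⟨MulAut.conjNormal g m, hMmin _ (hM.comap (MulAut.conjNormal g)) hm, rfl⟩⟩
  have hle := hmin _ (hL.map_subtype hM hMn)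
  obtain ⟨T, hT, hNT, hTN, hiso⟩ := exists_torsionRadical N
  -- Enlarging `N` to its torsion radical gives an isolated kernel of `L`; it contains `M`, which by
  -- `hle` is all of `L`, so `L` is torsion over `N`.
  have hTk : IsIsolatedKernel π T := IsIsolatedKernel.of_quotient
    (((isPiMinimax_iff hN.1 hN.2.1).1 hN).of_surjective (CyclicOrQuasicyclic.quotClosed _)
      (QuotientGroup.map N T (MonoidHom.id L) hNT) fun y => by
        obtain ⟨x, rfl⟩ := QuotientGroup.mk'_surjective T y
        exact ⟨(x : L ⧸ N), rfl⟩) hiso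
  intro y
  obtain ⟨x, rfl⟩ := QuotientGroup.mk'_surjective N y
  have hxM : x ∈ M := by
    obtain ⟨z, hz, hzx⟩ := hle x.2
    rwa [← show z = x from Subtype.ext hzx]
  obtain ⟨n, hn, h⟩ := hTN x (hMmin T hTk hxM)
  exact isOfFinOrder_iff_pow_eq_one.2 ⟨n, hn, (QuotientGroup.eq_one_iff _).2 h⟩

/-- The image of `N` in `G ⧸ L` is a `π`-minimax quotient of `N`, hence torsion, and isolation of
`L` makes it trivial. -/
theorem IsXGroup.le_of_isIsolatedKernel {π : Set Nat.Primes} {G : Type u} [Group G]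
    (hs : Group.IsSolvable G) (hm : IsMinimaxGroup G) {L N : Subgroup G}
    (hL : IsIsolatedKernel π L) (hN : N.Normal) (hNX : IsXGroup π N) : N ≤ L := by
  have hLn := hL.normal
  refine hL.isolated N hN fun x hx => ?_
  obtain ⟨g, hg⟩ := exists_injective_quotient (N := L.subgroupOf N) (M := L) N.subtype
    fun _ => Iff.rfl
  have hpi : IsPiMinimax π (N ⧸ L.subgroupOf N) :=
    (isPiMinimax_iff inferInstance
      ((hm.of_injective N.subtype N.subtype_injective).of_surjective _
        (QuotientGroup.mk'_surjective _))).2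
      (hL.polyClass_quotient.of_injective (CyclicOrQuasicyclic.subClosed _) g hg)
  obtain ⟨n, hn, h⟩ := isOfFinOrder_iff_pow_eq_one.1
    (hNX (L.subgroupOf N) hpi ((⟨x, hx⟩ : N) : N ⧸ L.subgroupOf N))
  exact ⟨n, hn, (QuotientGroup.eq_one_iff ((⟨x, hx⟩ : N) ^ n)).1 h⟩

theorem isIsolatedKernel_xRadical (π : Set Nat.Primes) {G : Type u} [Group G]
    (hs : Group.IsSolvable G) (hm : IsMinimaxGroup G) : IsIsolatedKernel π (xRadical π G) := by
  have hG := polyClass_of_isSolvable_of_isMinimaxGroup hs hm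
  obtain ⟨L, hL, hmin⟩ := IsIsolatedKernel.exists_least (π := π) hG
  have heq : xRadical π G = L := le_antisymm
    (sSup_le fun N hN => hN.2.le_of_isIsolatedKernel hs hm hL hN.1)
    (le_sSup ⟨hL.normal, isXGroup_of_least hG hL hmin⟩)
  rwa [heq]

theorem corollary5p15 (π : Set Nat.Primes) (G : Type*) [Group G]
    (hsolv : Group.IsSolvable G) (hmm : IsMinimaxGroup G) :
    IsVirtuallyTorsionFree (G ⧸ xRadical π G) ∧ IsPiMinimax π (G ⧸ xRadical π G) := by
  have h := isIsolatedKernel_xRadical π hsolv hmm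
  have hs : Group.IsSolvable (G ⧸ xRadical π G) := inferInstance
  have hm : IsMinimaxGroup (G ⧸ xRadical π G) :=
    hmm.of_surjective (QuotientGroup.mk' _) (QuotientGroup.mk'_surjective _)
  obtain ⟨n, hn⟩ := (Group.isSolvable_def _).1 hs
  exact ⟨isVirtuallyTorsionFree_of_isRadicallyIsolated_bot hn
    (polyClass_of_isSolvable_of_isMinimaxGroup hs hm) h.isolated.bot_quotient,
    (isPiMinimax_iff hs hm).2 h.polyClass_quotient⟩
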